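/- Let $n\ge 1$ be an integer. For a polynomial $q\in\mathbb{C}[t]$ put $$P_q=x_1^2\cdots x_n^2\,y+z^2+x_1\cdots x_n\,q(z^2)\in\mathbb{C}[x_1,\ldots,x_n,y,z].$$ A polynomial automorphism of $\mathbb{C}^m$ is a bijection $\Phi:\mathbb{C}^m\to\mathbb{C}^m$ such that $\Phi$ and $\Phi^{-1}$ are given by polynomials in the coordinates. Two polynomials $P,Q$ in $m$ variables over $\mathbb{C}$ are called equivalent if there is a polynomial automorphism $\Phi$ of $\mathbb{C}^m$ with $\Phi^*(P)=P\circ\Phi=Q$. Two hypersurfaces $H_1,H_2\subset\mathbb{C}^m$ are called equivalent if there is a polynomial automorphism $\Phi$ of $\mathbb{C}^m$ with $\Phi(H_1)=H_2$. Write $V(P)$ for the zero set of $P$. Let $q_1,q_2\in\mathbb{C}[t]$ and $c_1,c_2\in\mathbb{C}$. Then the following hold. 1. The polynomials $P_{q_1}-c_1$ and $P_{q_2}-c_2$ in $n+2$ variables are equivalent if and only if $c_1=c_2$ and there exists $\lambda\in\mathbb{C}^*$ such that $q_2=\lambda q_1$. 2. The hypersurfaces $V(P_{q_1}-c_1)$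 and $V(P_{q_2}-c_2)$ in $\mathbb{C}^{n+2}$ are equivalent if and only if there exist $\lambda,\mu\in\mathbb{C}^*$ such that $c_2=\mu^{-1}c_1$ and $q_2(t)=\lambda q_1(\mu t)$ in $\mathbb{C}[t]$. -/

import Mathlib

open MvPolynomial

noncomputable section

/-- A polynomial automorphism of `ℂ^m`: a bijection `Φ` of `ℂ^m` such that `Φ` and its inverse
are both given by polynomials in the coordinates. -/
structure PolyAut (m : ℕ) where
  /-- the bijection of `ℂ^m` -/
  toEquiv : (Fin m → ℂ) ≃ (Fin m → ℂ)
  /-- the coordinate polynomials of `Φ` -/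
  coord : Fin m → MvPolynomial (Fin m) ℂ
  /-- the coordinate polynomials of the inverse of `Φ` -/
  coordInv : Fin m → MvPolynomial (Fin m) ℂ
  apply_eq : ∀ x i, toEquiv x i = eval x (coord i)
  symm_apply_eq : ∀ x i, toEquiv.symm x i = eval x (coordInv i)

/-- The pull-back `Φ^*(P) = P ∘ Φ` on polynomials, i.e. substitution of the coordinate
polynomials of `Φ` for the variables. -/
def PolyAut.pullback {m : ℕ} (Φ : PolyAut m) :
    MvPolynomial (Fin m) ℂ →ₐ[ℂ] MvPolynomial (Fin m) ℂ :=
  aeval Φ.coord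

/-- `Φ^*(P)` is indeed the composite `P ∘ Φ` as a function on `ℂ^m`. -/
theorem PolyAut.eval_pullback {m : ℕ} (Φ : PolyAut m) (P : MvPolynomial (Fin m) ℂ)
    (x : Fin m → ℂ) : eval x (Φ.pullback P) = eval (Φ.toEquiv x) P := by
  induction P using MvPolynomial.induction_on with
  | C a => simp [PolyAut.pullback]
  | add p q hp hq => simp [hp, hq]
  | mul_X p i hp =>
    rw [map_mul, map_mul, map_mul, hp, eval_X, Φ.apply_eq]
    simp [PolyAut.pullback]

/-- Two subsets (in particular, two hypersurfaces) of `ℂ^m` are equivalent if some polynomial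
automorphism of `ℂ^m` maps the first onto the second. -/
def EquivalentSubsets {m : ℕ} (H₁ H₂ : Set (Fin m → ℂ)) : Prop :=
  ∃ Φ : PolyAut m, Φ.toEquiv '' H₁ = H₂

/-- Two polynomials `P`, `Q` in `m` variables are equivalent if `Φ^*(P) = Q` for some polynomial
automorphism `Φ` of `ℂ^m`. -/
def EquivalentPolynomials {m : ℕ} (P Q : MvPolynomial (Fin m) ℂ) : Prop :=
  ∃ Φ : PolyAut m, Φ.pullback P = Q

/-- The hypersurface `V(P)`, the zero set of `P` in `ℂ^m`. -/
def hypersurface {m : ℕ} (P : MvPolynomial (Fin m) ℂ) : Set (Fin m → ℂ) :=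
  zeroLocus ℂ (Ideal.span {P})

theorem mem_hypersurface {m : ℕ} (P : MvPolynomial (Fin m) ℂ) (v : Fin m → ℂ) :
    v ∈ hypersurface P ↔ eval v P = 0 := by
  simp [hypersurface, zeroLocus_span, aeval_eq_eval]

/-- The variable `x_i` of `ℂ[x_1, …, x_n, y, z]`. -/
def varx {n : ℕ} (i : Fin n) : MvPolynomial (Fin (n + 2)) ℂ := X (Fin.castAdd 2 i)

/-- The variable `y` of `ℂ[x_1, …, x_n, y, z]`. -/
def vary (n : ℕ) : MvPolynomial (Fin (n + 2)) ℂ := X (Fin.natAdd n 0)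

/-- The variable `z` of `ℂ[x_1, …, x_n, y, z]`. -/
def varz (n : ℕ) : MvPolynomial (Fin (n + 2)) ℂ := X (Fin.natAdd n 1)

/-- The monomial `x_1^k ⋯ x_n^k` of `ℂ[x_1, …, x_n, y, z]`. -/
def xpow (n k : ℕ) : MvPolynomial (Fin (n + 2)) ℂ := ∏ i : Fin n, varx i ^ k

/-- The polynomial `P_q = x_1^2 ⋯ x_n^2 y + z^2 + x_1 ⋯ x_n q(z^2)`. -/
def polyP (n : ℕ) (q : Polynomial ℂ) : MvPolynomial (Fin (n + 2)) ℂ :=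
  xpow n 2 * vary n + varz n ^ 2 + xpow n 1 * Polynomial.aeval (varz n ^ 2) q

end

/-! Write x = x_1⋯x_n. The tool is the locally nilpotent derivation D = x²∂_z − (∂P_q/∂z)∂_y
(`stdDer`), which kills every x_i and P_q. Let φ be an algebra automorphism with φ(P_{q₁}) = a
P_{q₂} + b, a ≠ 0. Conjugating the D of q₂ by φ gives a locally nilpotent derivation that kills
P_{q₁} and whose kernel contains a polynomial ring in n+1 variables. The crux, `apply_varx_eq_zero`,
is that such a derivation kills every x_i; it is then proportional to the D of q₁. So φ carries
kernel into kernel, which forces φ(z) = βz + w with w in the kernel, and makes φ permute the x_i up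
to scalars. Comparing φ(P_{q₁}) with a P_{q₂} + b at x_i = 0, using parity in z, gives b = 0 and α
q₁(at) = a q₂(t) (`rigidity`).

The crux is proved by passing to leading terms. Solving P_q = P for y embeds the polynomial ring in
Laurent series in the x_i and z over ℂ[P] (`laurent`). In a suitable order the leading term of y is
−x⁻²z², so leading exponents lie in the semigroup generated by those of the x_i, of z, and
(−2,…,−2,2). The leading part of a derivation killing P acts on monomials through an additive
character. Local nilpotency, together with a parity argument on the semigroup
(`weight_eq_zero_of_leading_exponents`), makes this character proportional to the exponent of z.
Kernel elements therefore have leading monomials in the x_i alone, and letting each x_i come first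
in the order puts the kernel inside ℂ[x_1,…,x_n,z,P] (`exists_substP_eq`). A transcendence degree
count then yields a nonzero kernel element divisible by x_i, and kernels are factorially closed.

The converses use diagonal automorphisms (`exists_polyAut`). Part 1 is the case a = 1. In part 2,
P_q − c is irreducible, so by the Nullstellensatz equal zero sets mean equality up to a constant a,
and `rigidity` applies with b = c₁ − a c₂. -/

set_option linter.unusedSectionVars false

/-! ### Locally nilpotent derivations. -/

section LocallyNilpotent

variable {A : Type*} [CommRing A] [Algebra ℂ A]

/-- A derivation is locally nilpotent if every element is killed by some iterate of it. -/
def LocallyNilpotent (E : Derivation ℂ A A) : Prop := ∀ f, ∃ k : ℕ, E^[k] f = 0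

theorem Derivation.iterate_zero' (E : Derivation ℂ A A) (k : ℕ) : E^[k] 0 = 0 :=
  iterate_map_zero E k

theorem Derivation.iterate_eq_zero_of_le (E : Derivation ℂ A A) {f : A} {k l : ℕ}
    (h : E^[k] f = 0) (hkl : k ≤ l) : E^[l] f = 0 := by
  obtain ⟨j, rfl⟩ := Nat.exists_eq_add_of_le hkl
  rw [add_comm, Function.iterate_add_apply, h, E.iterate_zero']

/-- The extreme terms of the iterated Leibniz rule. -/
theorem Derivation.iterate_mul_extreme (E : Derivation ℂ A A) (m l : ℕ) (f g : A)
    (hf : E^[m + 1] f = 0) (hg : E^[l + 1] g = 0) :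
    E^[m + l] (f * g) = ((m + l).choose m : A) * (E^[m] f * E^[l] g) ∧
      E^[m + l + 1] (f * g) = 0 := by
  have key : ∀ k : ℕ, E^[k + 1] (f * g) = E^[k] (f * E g) + E^[k] (E f * g) := by
    intro k
    rw [Function.iterate_succ_apply, E.leibniz, iterate_map_add]
    simp only [smul_eq_mul, mul_comm]
  induction m generalizing f g l with
  | zero =>
    have hf' : E f = 0 := by simpa using hf
    induction l generalizing g with
    | zero =>
      have hg' : E g = 0 := by simpa using hg
      simp [E.leibniz, hf', hg']
    | succ l ih =>
      have hk : ∀ k : ℕ, E^[k + 1] (f * g) = E^[k] (f * E g) := by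
        intro k; rw [key, hf', zero_mul, E.iterate_zero', add_zero]
      obtain ⟨h1, h2⟩ := ih (E g) (by simpa using hg) (fun k => by
        rw [Function.iterate_succ_apply, E.leibniz, iterate_map_add]
        simp only [smul_eq_mul, mul_comm])
      refine ⟨?_, ?_⟩
      · rw [← add_assoc, hk, h1]; simp
      · rw [← add_assoc, hk, h2]
  | succ m ihm =>
    induction l generalizing f g with
    | zero =>
      have hg' : E g = 0 := by simpa using hg
      have hk : ∀ k : ℕ, E^[k + 1] (f * g) = E^[k] (E f * g) := by
        intro k; rw [key, hg', mul_zero, E.iterate_zero', zero_add]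
      obtain ⟨h1, h2⟩ := ihm 0 (E f) g (by simpa using hf) hg (fun k => by
        rw [Function.iterate_succ_apply, E.leibniz, iterate_map_add]
        simp only [smul_eq_mul, mul_comm])
      refine ⟨?_, ?_⟩
      · rw [show m + 1 + 0 = m + 0 + 1 by ring, hk]; simpa using h1
      · rw [show m + 1 + 0 + 1 = (m + 0 + 1) + 1 by ring, hk, h2]
    | succ l ihl =>
      obtain ⟨h1, h2⟩ := ihl f (E g) hf (by simpa using hg) (fun k => by
        rw [Function.iterate_succ_apply, E.leibniz, iterate_map_add]
        simp only [smul_eq_mul, mul_comm])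
      obtain ⟨h3, h4⟩ := ihm (l + 1) (E f) g (by simpa using hf) hg (fun k => by
        rw [Function.iterate_succ_apply, E.leibniz, iterate_map_add]
        simp only [smul_eq_mul, mul_comm])
      refine ⟨?_, ?_⟩
      · rw [show m + 1 + (l + 1) = (m + 1 + l) + 1 by ring, key, h1,
          show m + 1 + l = m + (l + 1) by ring, h3, Nat.choose_succ_succ]
        simp only [← Function.iterate_succ_apply]
        push_cast
        ring
      · rw [show m + 1 + (l + 1) + 1 = (m + 1 + l + 1) + 1 by ring, key, h2,
          show m + 1 + l + 1 = m + (l + 1) + 1 by ring, h4, add_zero]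

theorem Derivation.exists_iterate_ne_zero (E : Derivation ℂ A A) {f : A} (hf : f ≠ 0)
    (h : ∃ k : ℕ, E^[k] f = 0) : ∃ m : ℕ, E^[m] f ≠ 0 ∧ E^[m + 1] f = 0 := by
  classical
  obtain ⟨m, hm⟩ : ∃ m, Nat.find h = m + 1 := by
    refine Nat.exists_eq_succ_of_ne_zero fun h0 => hf ?_
    have := Nat.find_spec h
    rwa [h0] at this
  exact ⟨m, Nat.find_min h (by omega), hm ▸ Nat.find_spec h⟩

/-- The kernel of a locally nilpotent derivation is factorially closed. -/
theorem LocallyNilpotent.eq_zero_of_mul [IsDomain A] {E : Derivation ℂ A A}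
    (hE : LocallyNilpotent E) {f g : A} (hf : f ≠ 0) (hg : g ≠ 0) (h : E (f * g) = 0) :
    E f = 0 := by
  have : CharZero A := charZero_of_injective_algebraMap (algebraMap ℂ A).injective
  obtain ⟨m, hm, hm'⟩ := E.exists_iterate_ne_zero hf (hE f)
  obtain ⟨l, hl, hl'⟩ := E.exists_iterate_ne_zero hg (hE g)
  -- In a domain of characteristic zero the nilpotency degrees m and l add: the middle Leibniz term
  -- is a nonzero multiple of a nonzero product. As E kills fg, both must be 0.
  have h1 := (E.iterate_mul_extreme m l f g hm' hl').1
  rcases Nat.eq_zero_or_pos m with rfl | hpos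
  · simpa using hm'
  · exfalso
    rw [E.iterate_eq_zero_of_le (k := 1) (by simpa using h) (by omega)] at h1
    exact mul_ne_zero (Nat.cast_ne_zero.2 (Nat.choose_pos (Nat.le_add_right m l)).ne')
      (mul_ne_zero hm hl) h1.symm

/-- The elements killed by some iterate of a derivation form a subalgebra. -/
def nilSubalgebra (E : Derivation ℂ A A) : Subalgebra ℂ A where
  carrier := {f | ∃ k : ℕ, E^[k] f = 0}
  mul_mem' := by
    rintro f g ⟨k, hk⟩ ⟨l, hl⟩
    exact ⟨_, (E.iterate_mul_extreme k l f g (E.iterate_eq_zero_of_le hk (by omega))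
      (E.iterate_eq_zero_of_le hl (by omega))).2⟩
  add_mem' := by
    rintro f g ⟨k, hk⟩ ⟨l, hl⟩
    refine ⟨k + l, ?_⟩
    rw [iterate_map_add, E.iterate_eq_zero_of_le hk (by omega),
      E.iterate_eq_zero_of_le hl (by omega), add_zero]
  algebraMap_mem' r := ⟨1, by simp⟩

theorem mem_nilSubalgebra (E : Derivation ℂ A A) (f : A) :
    f ∈ nilSubalgebra E ↔ ∃ k : ℕ, E^[k] f = 0 := Iff.rfl

theorem mem_nilSubalgebra_of_apply (E : Derivation ℂ A A) {f : A} (h : E f ∈ nilSubalgebra E) :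
    f ∈ nilSubalgebra E := by
  obtain ⟨k, hk⟩ := h
  exact ⟨k + 1, hk⟩

/-- The conjugate `φ⁻¹ ∘ E ∘ φ` of a derivation by an automorphism. -/
def Derivation.conj (E : Derivation ℂ A A) (φ : A ≃ₐ[ℂ] A) : Derivation ℂ A A :=
  Derivation.mk' (φ.symm.toLinearMap ∘ₗ E.toLinearMap ∘ₗ φ.toLinearMap) (by
    intro a b
    simp)

@[simp] theorem Derivation.conj_apply (E : Derivation ℂ A A) (φ : A ≃ₐ[ℂ] A) (f : A) :
    E.conj φ f = φ.symm (E (φ f)) := rfl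

theorem Derivation.conj_iterate (E : Derivation ℂ A A) (φ : A ≃ₐ[ℂ] A) (k : ℕ) (f : A) :
    (E.conj φ)^[k] f = φ.symm (E^[k] (φ f)) := by
  induction k generalizing f with
  | zero => simp
  | succ k ih => rw [Function.iterate_succ_apply, ih]; simp

theorem LocallyNilpotent.conj {E : Derivation ℂ A A} (hE : LocallyNilpotent E)
    (φ : A ≃ₐ[ℂ] A) : LocallyNilpotent (E.conj φ) := fun f => by
  obtain ⟨k, hk⟩ := hE (φ f)
  exact ⟨k, by rw [E.conj_iterate, hk, map_zero]⟩

end LocallyNilpotent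

/-! ### The standard derivation and parity in z. -/

section Coordinates

variable {n : ℕ} {B : Type*} [CommRing B] [Algebra ℂ B]

local notation "A" => MvPolynomial (Fin (n + 2)) ℂ

noncomputable section

/-- The substitution of `u i`, `v`, `w` for the variables `x_i`, `y`, `z`. -/
def subst (u : Fin n → B) (v w : B) : MvPolynomial (Fin (n + 2)) ℂ →ₐ[ℂ] B :=
  aeval (Fin.append u ![v, w])

@[simp] theorem subst_varx (u : Fin n → B) (v w : B) (i : Fin n) :
    subst u v w (varx i) = u i := by simp [subst, varx]

@[simp] theorem subst_vary (u : Fin n → B) (v w : B) : subst u v w (vary n) = v := by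
  simp only [subst, vary, aeval_X, Fin.append_right]; rfl

@[simp] theorem subst_varz (u : Fin n → B) (v w : B) : subst u v w (varz n) = w := by
  simp only [subst, varz, aeval_X, Fin.append_right]; rfl

theorem forall_var {p : MvPolynomial (Fin (n + 2)) ℂ → Prop} (hx : ∀ i : Fin n, p (varx i))
    (hy : p (vary n)) (hz : p (varz n)) (i : Fin (n + 2)) : p (X i) := by
  induction i using Fin.addCases with
  | left i => exact hx i
  | right j => fin_cases j; exacts [hy, hz]

theorem algHom_ext_var {f g : MvPolynomial (Fin (n + 2)) ℂ →ₐ[ℂ] B}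
    (hx : ∀ i : Fin n, f (varx i) = g (varx i)) (hy : f (vary n) = g (vary n))
    (hz : f (varz n) = g (varz n)) : f = g :=
  MvPolynomial.algHom_ext (forall_var (p := fun t => f t = g t) hx hy hz)

theorem derivation_ext_var {M : Type*} [AddCommGroup M] [Module ℂ M]
    [Module (MvPolynomial (Fin (n + 2)) ℂ) M]
    {f g : Derivation ℂ (MvPolynomial (Fin (n + 2)) ℂ) M}
    (hx : ∀ i : Fin n, f (varx i) = g (varx i)) (hy : f (vary n) = g (vary n))
    (hz : f (varz n) = g (varz n)) : f = g :=
  MvPolynomial.derivation_ext (forall_var (p := fun t => f t = g t) hx hy hz)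

theorem subalgebra_eq_top {S : Subalgebra ℂ (MvPolynomial (Fin (n + 2)) ℂ)}
    (hx : ∀ i : Fin n, varx i ∈ S) (hy : vary n ∈ S) (hz : varz n ∈ S) : S = ⊤ := by
  rw [eq_top_iff, ← MvPolynomial.adjoin_range_X]
  refine Algebra.adjoin_le ?_
  rintro _ ⟨i, rfl⟩
  exact forall_var (p := fun t => t ∈ S) hx hy hz i

/-- The product `x_1 ⋯ x_n`. -/
def xprod (n : ℕ) : MvPolynomial (Fin (n + 2)) ℂ := ∏ i : Fin n, varx i

theorem polyP_eq (n : ℕ) (q : Polynomial ℂ) : polyP n q = xprod n ^ 2 * vary n + varz n ^ 2 +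
    xprod n * Polynomial.aeval (varz n ^ 2) q := by
  simp [polyP, xpow, xprod, Finset.prod_pow]

theorem varx_ne_zero (i : Fin n) : (varx i : A) ≠ 0 := X_ne_zero _

theorem varz_ne_zero : (varz n : A) ≠ 0 := X_ne_zero _

theorem xprod_ne_zero : xprod n ≠ 0 := Finset.prod_ne_zero_iff.2 fun i _ => varx_ne_zero i

theorem varx_dvd_xprod (i : Fin n) : (varx i : A) ∣ xprod n :=
  Finset.dvd_prod_of_mem _ (Finset.mem_univ i)

theorem map_polyP (f : A →ₐ[ℂ] B) (q : Polynomial ℂ) :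
    f (polyP n q) = f (xprod n) ^ 2 * f (vary n) + f (varz n) ^ 2 +
      f (xprod n) * Polynomial.aeval (f (varz n) ^ 2) q := by
  rw [polyP_eq]
  simp [Polynomial.aeval_algHom_apply, ← map_pow]

theorem map_xprod (f : A →ₐ[ℂ] B) : f (xprod n) = ∏ i : Fin n, f (varx i) := map_prod f _ _

/-- The partial derivative of `polyP n q` with respect to `z`. -/
def polyPz (n : ℕ) (q : Polynomial ℂ) : MvPolynomial (Fin (n + 2)) ℂ :=
  2 * varz n * (1 + xprod n * Polynomial.aeval (varz n ^ 2) (Polynomial.derivative q))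

/-- The derivation `(x_1 ⋯ x_n)² ∂_z - (∂_z P) ∂_y`. -/
def stdDer (n : ℕ) (q : Polynomial ℂ) :
    Derivation ℂ (MvPolynomial (Fin (n + 2)) ℂ) (MvPolynomial (Fin (n + 2)) ℂ) :=
  mkDerivation ℂ (Fin.append (fun _ => 0) ![-polyPz n q, xprod n ^ 2])

variable (q : Polynomial ℂ)

@[simp] theorem stdDer_varx (i : Fin n) : stdDer n q (varx i) = 0 := by
  simp [stdDer, varx, mkDerivation_X]

@[simp] theorem stdDer_vary : stdDer n q (vary n) = -polyPz n q := by
  simp only [stdDer, vary, mkDerivation_X, Fin.append_right]; rfl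

@[simp] theorem stdDer_varz : stdDer n q (varz n) = xprod n ^ 2 := by
  simp only [stdDer, varz, mkDerivation_X, Fin.append_right]; rfl

theorem Derivation.map_xprod_eq_zero (E : Derivation ℂ A A) (h : ∀ i : Fin n, E (varx i) = 0) :
    E (xprod n) = 0 := by
  rw [xprod]
  refine Finset.prod_induction (s := Finset.univ) (f := fun i : Fin n => varx i)
    (fun t => E t = 0) (fun a b ha hb => by simp [E.leibniz, ha, hb]) (by simp) (fun i _ => h i)

@[simp] theorem stdDer_xprod : stdDer n q (xprod n) = 0 :=
  (stdDer n q).map_xprod_eq_zero (stdDer_varx q)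

theorem Derivation.map_polyP (E : Derivation ℂ A A) (h : ∀ i : Fin n, E (varx i) = 0) :
    E (polyP n q) = xprod n ^ 2 * E (vary n) + polyPz n q * E (varz n) := by
  rw [polyP_eq]
  simp only [map_add, E.leibniz, E.leibniz_pow, E.map_aeval, E.map_xprod_eq_zero h, polyPz]
  simp
  ring

@[simp] theorem stdDer_polyP : stdDer n q (polyP n q) = 0 := by
  rw [(stdDer n q).map_polyP q (stdDer_varx q)]
  simp; ring

/-- The derivation is triangular: it kills the x_i, sends z into ℂ[x_i], and sends y into ℂ[x_i, z].
-/
theorem stdDer_locallyNilpotent : LocallyNilpotent (stdDer n q) := by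
  have hx : ∀ i : Fin n, varx i ∈ nilSubalgebra (stdDer n q) := fun i => ⟨1, by simp⟩
  have hz : varz n ∈ nilSubalgebra (stdDer n q) := ⟨2, by simp [Derivation.leibniz_pow]⟩
  have hy : vary n ∈ nilSubalgebra (stdDer n q) := by
    refine mem_nilSubalgebra_of_apply _ ?_
    rw [stdDer_vary, polyPz]
    refine neg_mem (mul_mem (mul_mem (by exact_mod_cast natCast_mem (nilSubalgebra (stdDer n q)) 2) hz) (add_mem (one_mem _)
      (mul_mem (prod_mem fun i _ => hx i) ?_)))
    exact Algebra.adjoin_le (Set.singleton_subset_iff.2 (pow_mem hz 2))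
      (Polynomial.aeval_mem_adjoin_singleton ℂ _)
  intro f
  rw [← mem_nilSubalgebra, subalgebra_eq_top hx hy hz]
  exact Algebra.mem_top

/-- The involution `z ↦ -z`. -/
def flipz (n : ℕ) : MvPolynomial (Fin (n + 2)) ℂ →ₐ[ℂ] MvPolynomial (Fin (n + 2)) ℂ :=
  subst varx (vary n) (-varz n)

@[simp] theorem flipz_varx (i : Fin n) : flipz n (varx i) = varx i := subst_varx _ _ _ i
@[simp] theorem flipz_vary : flipz n (vary n) = vary n := subst_vary _ _ _
@[simp] theorem flipz_varz : flipz n (varz n) = -varz n := subst_varz _ _ _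
@[simp] theorem flipz_xprod : flipz n (xprod n) = xprod n := by simp [map_xprod]; rfl

@[simp] theorem flipz_flipz (f : A) : flipz n (flipz n f) = f := by
  have : (flipz n).comp (flipz n) = AlgHom.id ℂ A := algHom_ext_var (by simp) (by simp) (by simp)
  exact DFunLike.congr_fun this f

/-- `flipz` as an automorphism. -/
def flipzEquiv (n : ℕ) : MvPolynomial (Fin (n + 2)) ℂ ≃ₐ[ℂ] MvPolynomial (Fin (n + 2)) ℂ :=
  AlgEquiv.ofAlgHom (flipz n) (flipz n) (AlgHom.ext flipz_flipz) (AlgHom.ext flipz_flipz)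

/-- P_q depends on z only through z², so ∂P_q/∂z is odd in z while x² is even; hence the involution
conjugates D to −D. -/
theorem stdDer_flipz (f : A) : stdDer n q (flipz n f) = -flipz n (stdDer n q f) := by
  have h : (stdDer n q).conj (flipzEquiv n) = -stdDer n q := by
    have hf : ∀ g : A, flipzEquiv n g = flipz n g := fun _ => rfl
    have hs : ∀ g : A, (flipzEquiv n).symm g = flipz n g := fun _ => rfl
    refine derivation_ext_var (by simp [hf]) ?_ (by simp [hf, hs])
    have h2 : flipz n 2 = 2 := map_ofNat _ 2
    simp [hf, hs, polyPz, ← Polynomial.aeval_algHom_apply, h2]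
  have := DFunLike.congr_fun h f
  change flipz n (stdDer n q (flipz n f)) = -stdDer n q f at this
  rw [← flipz_flipz (stdDer n q (flipz n f)), this, map_neg]

theorem varz_dvd_iff (f : A) : varz n ∣ f ↔ subst varx (vary n) 0 f = 0 := by
  constructor
  · rintro ⟨g, rfl⟩; simp
  · intro h
    have : ((Ideal.Quotient.mkₐ ℂ (Ideal.span {varz n})).comp (subst varx (vary n) 0)) =
        Ideal.Quotient.mkₐ ℂ (Ideal.span {varz n}) := by
      refine algHom_ext_var (by simp) (by simp) ?_
      simp only [AlgHom.comp_apply, subst_varz, map_zero, Ideal.Quotient.mkₐ_eq_mk]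
      exact (Ideal.Quotient.eq_zero_iff_mem.2 (Ideal.mem_span_singleton_self _)).symm
    have h2 := DFunLike.congr_fun this f
    rw [AlgHom.comp_apply, h, map_zero, Ideal.Quotient.mkₐ_eq_mk] at h2
    exact Ideal.mem_span_singleton.1 (Ideal.Quotient.eq_zero_iff_mem.1 h2.symm)

theorem varz_dvd_of_flipz_eq_neg {f : A} (h : flipz n f = -f) : varz n ∣ f := by
  rw [varz_dvd_iff]
  have h1 : (subst varx (vary n) (0 : A)).comp (flipz n) = subst varx (vary n) (0 : A) :=
    algHom_ext_var (by simp) (by simp) (by simp)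
  have h2 := DFunLike.congr_fun h1 f
  rw [AlgHom.comp_apply, h, map_neg] at h2
  exact self_eq_neg.1 h2.symm

/-- The kernel of `stdDer` consists of even polynomials in `z`. -/
theorem flipz_of_stdDer_eq_zero {f : A} (h : stdDer n q f = 0) : flipz n f = f := by
  by_contra hne
  have hne' : f - flipz n f ≠ 0 := fun h0 => hne (sub_eq_zero.1 h0).symm
  -- The odd part of f is again in the kernel and divisible by z. Were it nonzero, factorial
  -- closedness would put z in the kernel, but D z = x².
  obtain ⟨g, hg⟩ := varz_dvd_of_flipz_eq_neg (f := f - flipz n f) (by simp)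
  have hD : stdDer n q (varz n * g) = 0 := by rw [← hg, map_sub, stdDer_flipz, h]; simp
  have := (stdDer_locallyNilpotent q).eq_zero_of_mul varz_ne_zero
    (fun h0 => hne' (by rw [hg, h0, mul_zero])) hD
  rw [stdDer_varz] at this
  exact pow_ne_zero 2 xprod_ne_zero this

end

end Coordinates

noncomputable section

/-! ### Leading terms of Hahn series and Euler derivations. -/

section HasLead

variable {Γ R : Type*} [AddCommGroup Γ] [LinearOrder Γ] [IsOrderedAddMonoid Γ] [CommRing R]

/-- The Hahn series `f` vanishes below `u` and has coefficient `c` at `u`. -/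
def HasLead (f : HahnSeries Γ R) (u : Γ) (c : R) : Prop :=
  (∀ v < u, f.coeff v = 0) ∧ f.coeff u = c

theorem HasLead.mul {f g : HahnSeries Γ R} {u v : Γ} {c d : R} (hf : HasLead f u c)
    (hg : HasLead g v d) : HasLead (f * g) (u + v) (c * d) := by
  have key : ∀ i j : Γ, i ∈ f.support → j ∈ g.support → u ≤ i ∧ v ≤ j := fun i j hi hj =>
    ⟨not_lt.1 fun h => hi (hf.1 i h), not_lt.1 fun h => hj (hg.1 j h)⟩
  refine ⟨fun w hw => ?_, ?_⟩
  · rw [HahnSeries.coeff_mul]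
    refine Finset.sum_eq_zero fun ij hij => ?_
    rw [Finset.mem_antidiagonal] at hij
    obtain ⟨h1, h2⟩ := key _ _ hij.1 hij.2.1
    exact absurd (add_le_add h1 h2) (by rw [hij.2.2]; exact not_le.2 hw)
  · rw [HahnSeries.coeff_mul, Finset.sum_eq_single (u, v), hf.2, hg.2]
    · rintro ⟨i, j⟩ hij hne
      rw [Finset.mem_antidiagonal] at hij
      obtain ⟨h1, h2⟩ := key _ _ hij.1 hij.2.1
      exfalso
      apply hne
      have hij' : i + j = u + v := hij.2.2
      have hi : i = u := by
        refine le_antisymm (not_lt.1 fun h => ?_) h1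
        exact (add_lt_add_of_lt_of_le h h2).ne' hij'
      subst hi
      rw [add_left_cancel hij']
    · intro h
      rw [Finset.mem_antidiagonal] at h
      by_contra hne
      exact h ⟨left_ne_zero_of_mul hne, right_ne_zero_of_mul hne, rfl⟩

theorem hasLead_single (u : Γ) (c : R) : HasLead (HahnSeries.single u c) u c :=
  ⟨fun _ h => HahnSeries.coeff_single_of_ne h.ne, HahnSeries.coeff_single_same u c⟩

theorem hasLead_one : HasLead (1 : HahnSeries Γ R) 0 1 := hasLead_single 0 1

theorem HasLead.pow {f : HahnSeries Γ R} {u : Γ} {c : R} (hf : HasLead f u c) (k : ℕ) :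
    HasLead (f ^ k) (k • u) (c ^ k) := by
  induction k with
  | zero => simpa using hasLead_one
  | succ k ih => rw [pow_succ, succ_nsmul, pow_succ]; exact ih.mul hf

theorem HasLead.add {f g : HahnSeries Γ R} {u : Γ} {c d : R} (hf : HasLead f u c)
    (hg : HasLead g u d) : HasLead (f + g) u (c + d) :=
  ⟨fun v hv => by rw [HahnSeries.coeff_add, hf.1 v hv, hg.1 v hv, add_zero],
    by rw [HahnSeries.coeff_add, hf.2, hg.2]⟩

theorem HasLead.neg {f : HahnSeries Γ R} {u : Γ} {c : R} (hf : HasLead f u c) :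
    HasLead (-f) u (-c) :=
  ⟨fun v hv => by rw [HahnSeries.coeff_neg, hf.1 v hv, neg_zero],
    by rw [HahnSeries.coeff_neg, hf.2]⟩

/-- The coefficient 0 is allowed, so the same predicate also records mere lower bounds on the
support. -/
theorem HasLead.of_lt {f : HahnSeries Γ R} {u v : Γ} {c : R} (hf : HasLead f u c) (h : v < u) :
    HasLead f v 0 := ⟨fun w hw => hf.1 w (hw.trans h), hf.1 v h⟩

theorem hasLead_sum {ι : Type*} (s : Finset ι) (f : ι → HahnSeries Γ R) (u : Γ) (c : ι → R)
    (h : ∀ i ∈ s, HasLead (f i) u (c i)) : HasLead (∑ i ∈ s, f i) u (∑ i ∈ s, c i) := by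
  classical
  induction s using Finset.induction_on with
  | empty => simp [HasLead]
  | insert a s ha ih =>
    rw [Finset.sum_insert ha, Finset.sum_insert ha]
    exact (h a (by simp)).add (ih fun i hi => h i (by simp [hi]))

theorem HasLead.unique {f : HahnSeries Γ R} {u v : Γ} {c d : R} (hf : HasLead f u c)
    (hg : HasLead f v d) (hc : c ≠ 0) (hd : d ≠ 0) : u = v := by
  rcases lt_trichotomy u v with h | h | h
  · exact absurd (hf.2.symm.trans (hg.1 u h)) hc
  · exact h
  · exact absurd (hg.2.symm.trans (hf.1 v h)) hd

theorem HasLead.ne_zero {f : HahnSeries Γ R} {u : Γ} {c : R} (hf : HasLead f u c) (hc : c ≠ 0) :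
    f ≠ 0 := by
  rintro rfl
  exact hc hf.2.symm

/-- The Euler derivation of a Hahn series algebra given by an additive character. -/
def eulerDer (χ : Γ →+ ℤ) :
    Derivation ℂ (HahnSeries Γ (Polynomial ℂ)) (HahnSeries Γ (Polynomial ℂ)) :=
  Derivation.mk'
    { toFun := fun f => ⟨fun u => χ u • f.coeff u, f.isPWO_support.mono (by
        intro u hu h0
        simp [h0] at hu)⟩
      map_add' := fun f g => by ext1; funext u; simp
      map_smul' := fun c f => by ext1; funext u; simp [smul_comm] }
    (by
      intro f g
      ext1
      funext u
      let Df : HahnSeries Γ (Polynomial ℂ) := ⟨fun u => χ u • f.coeff u,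
        f.isPWO_support.mono (by intro u hu h0; simp [h0] at hu)⟩
      let Dg : HahnSeries Γ (Polynomial ℂ) := ⟨fun u => χ u • g.coeff u,
        g.isPWO_support.mono (by intro u hu h0; simp [h0] at hu)⟩
      change χ u • (f * g).coeff u = (f * Dg + g * Df).coeff u
      have h1 : Df.support ⊆ f.support := fun u hu h0 => hu (by simp [Df, h0])
      have h2 : Dg.support ⊆ g.support := fun u hu h0 => hu (by simp [Dg, h0])
      rw [mul_comm g Df, HahnSeries.coeff_add, HahnSeries.coeff_mul,
        HahnSeries.coeff_mul_left' f.isPWO_support h1,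
        HahnSeries.coeff_mul_right' g.isPWO_support h2, ← Finset.sum_add_distrib, Finset.smul_sum]
      refine Finset.sum_congr rfl fun ij hij => ?_
      rw [Finset.mem_antidiagonal] at hij
      rw [← hij.2.2, map_add]
      simp only [Df, Dg, zsmul_eq_mul]
      push_cast
      ring)

theorem eulerDer_coeff (χ : Γ →+ ℤ) (f : HahnSeries Γ (Polynomial ℂ)) (u : Γ) :
    (eulerDer χ f).coeff u = χ u • f.coeff u := rfl

theorem HasLead.eulerDer {f : HahnSeries Γ (Polynomial ℂ)} {u : Γ} {c : Polynomial ℂ}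
    (hf : HasLead f u c) (χ : Γ →+ ℤ) : HasLead (eulerDer χ f) u (χ u • c) :=
  ⟨fun v hv => by rw [eulerDer_coeff, hf.1 v hv, smul_zero], by rw [eulerDer_coeff, hf.2]⟩

end HasLead

/-! ### Normal forms over ℂ[P]. -/

section Standard

variable {n : ℕ}

local notation "A" => MvPolynomial (Fin (n + 2)) ℂ

/-- The monomial `x^a z^b y^k`. -/
def stdMon (m : (Fin n → ℕ) × ℕ × ℕ) : MvPolynomial (Fin (n + 2)) ℂ :=
  (∏ i, varx i ^ m.1 i) * varz n ^ m.2.1 * vary n ^ m.2.2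

/-- The monomial `x^a z^b y^k` is not divisible by `x_1² ⋯ x_n² y`. -/
def IsReducedExp (m : (Fin n → ℕ) × ℕ × ℕ) : Prop := m.2.2 = 0 ∨ ∃ i, m.1 i < 2

/-- The linear combination of reduced monomials with coefficients in `ℂ[P]`. -/
def redComb (n : ℕ) (q : Polynomial ℂ) :
    ({m : (Fin n → ℕ) × ℕ × ℕ // IsReducedExp m} →₀ Polynomial ℂ) →ₗ[ℂ]
      MvPolynomial (Fin (n + 2)) ℂ :=
  Finsupp.lsum ℂ fun m => LinearMap.mulRight ℂ (stdMon m.1) ∘ₗ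
    (Polynomial.aeval (polyP n q)).toLinearMap

variable (q : Polynomial ℂ)

theorem redComb_apply (c : {m : (Fin n → ℕ) × ℕ × ℕ // IsReducedExp m} →₀ Polynomial ℂ) :
    redComb n q c = ∑ m ∈ c.support, Polynomial.aeval (polyP n q) (c m) * stdMon m.1 := by
  rw [redComb, Finsupp.lsum_apply]; rfl

theorem polyP_mul_mem_range {f : A} (hf : f ∈ LinearMap.range (redComb n q)) :
    polyP n q * f ∈ LinearMap.range (redComb n q) := by
  obtain ⟨c, rfl⟩ := hf
  induction c using Finsupp.induction_linear with
  | zero => simp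
  | add c d hc hd => rw [map_add, mul_add]; exact add_mem hc hd
  | single m p =>
    refine ⟨Finsupp.single m (Polynomial.X * p), ?_⟩
    simp only [redComb, Finsupp.lsum_single, LinearMap.comp_apply, AlgHom.toLinearMap_apply,
      LinearMap.mulRight_apply, map_mul, Polynomial.aeval_X, mul_assoc]

/-- Replacing a factor x²y by P − z² − x q(z²) lowers the exponent of y, which makes induction on k
work. -/
theorem stdMon_mem_range_redComb (k : ℕ) (a : Fin n → ℕ) (b : ℕ) :
    stdMon (a, b, k) ∈ LinearMap.range (redComb n q) := by
  induction k generalizing a b with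
  | zero => exact ⟨Finsupp.single ⟨(a, b, 0), Or.inl rfl⟩ 1, by simp [redComb]⟩
  | succ k ih =>
    by_cases h : ∃ i, a i < 2
    · exact ⟨Finsupp.single ⟨(a, b, k + 1), Or.inr h⟩ 1, by simp [redComb]⟩
    · push Not at h
      obtain ⟨a', rfl⟩ : ∃ a' : Fin n → ℕ, a = fun i => a' i + 2 :=
        ⟨fun i => a i - 2, funext fun i => (Nat.sub_add_cancel (h i)).symm⟩
      have hs : ∀ j, stdMon (fun i => a' i + 1, b + 2 * j, k) =
          xprod n * (varz n ^ 2) ^ j * stdMon (a', b, k) := by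
        intro j
        simp only [stdMon, xprod, pow_add, Finset.prod_mul_distrib, pow_one]
        ring
      have : stdMon (fun i => a' i + 2, b, k + 1) = polyP n q * stdMon (a', b, k) -
          stdMon (a', b + 2, k) - ∑ j ∈ Finset.range (q.natDegree + 1),
            q.coeff j • stdMon (fun i => a' i + 1, b + 2 * j, k) := by
        have hsum : ∑ j ∈ Finset.range (q.natDegree + 1),
            q.coeff j • stdMon (fun i => a' i + 1, b + 2 * j, k) =
            xprod n * Polynomial.aeval (varz n ^ 2) q * stdMon (a', b, k) := by
          rw [Polynomial.aeval_eq_sum_range, Finset.mul_sum, Finset.sum_mul]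
          refine Finset.sum_congr rfl fun j _ => ?_
          rw [hs, mul_smul_comm, smul_mul_assoc]
        rw [hsum, polyP_eq]
        simp only [stdMon, xprod, pow_add, Finset.prod_mul_distrib, Finset.prod_pow]
        ring
      rw [this]
      exact sub_mem (sub_mem (polyP_mul_mem_range q (ih _ _)) (ih _ _))
        (sum_mem fun j _ => Submodule.smul_mem _ _ (ih _ _))

theorem redComb_surjective : Function.Surjective (redComb n q) := by
  classical
  rw [← LinearMap.range_eq_top, eq_top_iff]
  have hspan : ∀ f : A, f ∈ Submodule.span ℂ (Set.range (stdMon (n := n))) := by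
    intro f
    induction f using MvPolynomial.induction_on with
    | C a =>
      have : (C a : A) = a • stdMon ((fun _ => 0), 0, 0) := by simp [stdMon, smul_eq_C_mul]
      rw [this]
      exact Submodule.smul_mem _ _ (Submodule.subset_span ⟨_, rfl⟩)
    | add f g hf hg => exact add_mem hf hg
    | mul_X f i hf =>
      induction hf using Submodule.span_induction with
      | zero => simp
      | add f g _ _ hf hg => rw [add_mul]; exact add_mem hf hg
      | smul c f _ hf => rw [smul_mul_assoc]; exact Submodule.smul_mem _ _ hf
      | mem f hf =>
        obtain ⟨⟨a, b, k⟩, rfl⟩ := hf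
        refine Submodule.subset_span ?_
        revert i
        refine forall_var (p := fun t => stdMon (a, b, k) * t ∈ Set.range (stdMon (n := n)))
          (fun i => ⟨(a + Pi.single i 1, b, k), ?_⟩) ⟨(a, b, k + 1), ?_⟩ ⟨(a, b + 1, k), ?_⟩
        · simp only [stdMon, Pi.add_apply, pow_add, Finset.prod_mul_distrib]
          rw [Finset.prod_eq_single (f := fun x => varx x ^ (Pi.single i 1 : Fin n → ℕ) x) i
            (fun j _ hj => by simp [Pi.single_eq_of_ne hj]) (by simp)]
          simp
          ring
        · simp only [stdMon]; ring
        · simp only [stdMon]; ring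
  intro f _
  refine (Submodule.span_le.2 ?_) (hspan f)
  rintro _ ⟨⟨a, b, k⟩, rfl⟩
  exact stdMon_mem_range_redComb q k a b

end Standard

/-! ### The Laurent embedding and leading exponents. -/

section Laurent

variable {n : ℕ} {Γ : Type*} [AddCommGroup Γ] [LinearOrder Γ] [IsOrderedAddMonoid Γ]

local notation "A" => MvPolynomial (Fin (n + 2)) ℂ

variable (e : ((Fin n → ℤ) × ℤ) ≃+ Γ) (q : Polynomial ℂ)

/-- The Laurent monomial `x^u.1 z^u.2`. -/
def mono (u : (Fin n → ℤ) × ℤ) : HahnSeries Γ (Polynomial ℂ) := HahnSeries.single (e u) 1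

theorem mono_mul (u v : (Fin n → ℤ) × ℤ) : mono e u * mono e v = mono e (u + v) := by
  simp [mono, HahnSeries.single_mul_single]

@[simp] theorem mono_zero : mono e 0 = 1 := by simp [mono]

theorem mono_pow (u : (Fin n → ℤ) × ℤ) (k : ℕ) : mono e u ^ k = mono e (k • u) := by
  rw [mono, HahnSeries.single_pow, one_pow, ← map_nsmul, mono]

theorem hasLead_mono (u : (Fin n → ℤ) × ℤ) : HasLead (mono e u) (e u) 1 := hasLead_single _ _

theorem mono_ne_zero (u : (Fin n → ℤ) × ℤ) : mono e u ≠ 0 :=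
  (hasLead_mono e u).ne_zero one_ne_zero

/-- The image of `y` in the Laurent algebra. -/
def laurentY : HahnSeries Γ (Polynomial ℂ) :=
  mono e (-2, 0) * (HahnSeries.C Polynomial.X - mono e (0, 2) -
    mono e (1, 0) * Polynomial.aeval (mono e (0, 2)) q)

/-- The embedding of the polynomial ring in the Laurent algebra over `ℂ[P]`. -/
def laurent : MvPolynomial (Fin (n + 2)) ℂ →ₐ[ℂ] HahnSeries Γ (Polynomial ℂ) :=
  subst (fun i => mono e (Pi.single i 1, 0)) (laurentY e q) (mono e (0, 1))

@[simp] theorem laurent_varx (i : Fin n) :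
    laurent e q (varx i) = mono e (Pi.single i 1, 0) := subst_varx _ _ _ _
@[simp] theorem laurent_vary : laurent e q (vary n) = laurentY e q := subst_vary _ _ _
@[simp] theorem laurent_varz : laurent e q (varz n) = mono e (0, 1) := subst_varz _ _ _

theorem prod_mono_pow (a : Fin n → ℕ) : ∏ i, mono e (Pi.single i 1, 0) ^ a i =
    mono e (fun i => (a i : ℤ), 0) := by
  have h : ∀ s : Finset (Fin n), ∏ i ∈ s, mono e (Pi.single i 1, 0) ^ a i =
      mono e (∑ i ∈ s, a i • (Pi.single i 1, 0)) := by
    classical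
    intro s
    induction s using Finset.induction_on with
    | empty => simp
    | insert i s hi ih => rw [Finset.prod_insert hi, Finset.sum_insert hi, ih, mono_pow, mono_mul]
  rw [h]
  congr 1
  ext j
  · simp [Prod.fst_sum, Finset.sum_apply, Pi.single_apply]
  · simp [Prod.snd_sum]

@[simp] theorem laurent_xprod : laurent e q (xprod n) = mono e (1, 0) := by
  rw [map_xprod]
  simpa using! prod_mono_pow e (fun _ => 1)

@[simp] theorem laurent_polyP : laurent e q (polyP n q) = HahnSeries.C Polynomial.X := by
  rw [map_polyP, laurent_xprod, laurent_vary, laurent_varz, laurentY, ← mul_assoc, mono_pow,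
    mono_mul, mono_pow]
  have h1 : (2 • (1, 0) + (-2, 0) : (Fin n → ℤ) × ℤ) = 0 := by
    ext <;> simp
  have h2 : (2 • (0, 1) : (Fin n → ℤ) × ℤ) = (0, 2) := by
    ext <;> simp
  rw [h1, h2, mono_zero]
  ring

theorem laurent_aeval_polyP (p : Polynomial ℂ) :
    laurent e q (Polynomial.aeval (polyP n q) p) = HahnSeries.C p := by
  rw [← Polynomial.aeval_algHom_apply, laurent_polyP]
  induction p using Polynomial.induction_on' with
  | add p r hp hr => rw [map_add, hp, hr, map_add]
  | monomial k c =>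
    rw [Polynomial.aeval_monomial, ← map_pow, HahnSeries.algebraMap_apply, ← map_mul,
      ← Polynomial.C_mul_X_pow_eq_monomial]
    rfl

variable (hz : e (0, 1) < 0) (hx : ∀ k : ℤ, 0 < e (1, k))

-- In the bracket defining `laurentY` the term −z² leads: z² has negative exponent, so it lies below
-- P, and every x z^{2i} lies above it.
include hz hx in
theorem hasLead_laurentY : HasLead (laurentY e q) (e (-2, 2)) (-1) := by
  have hz2 : e (0, 2) < 0 := by
    have : ((0, 2) : (Fin n → ℤ) × ℤ) = (0, 1) + (0, 1) := by ext <;> simp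
    rw [this, map_add]
    exact add_neg hz hz
  have h1 : HasLead (HahnSeries.C Polynomial.X : HahnSeries Γ (Polynomial ℂ)) (e (0, 2)) 0 :=
    (hasLead_single 0 Polynomial.X).of_lt hz2
  have h2 : HasLead (-mono e (0, 2)) (e (0, 2)) (-1) :=
    (hasLead_mono e (0, 2)).neg
  have h3 : HasLead (-(mono e (1, 0) * Polynomial.aeval (mono e (0, 2)) q)) (e (0, 2)) 0 := by
    rw [Polynomial.aeval_def, Polynomial.eval₂_eq_sum_range, Finset.mul_sum,
      ← Finset.sum_neg_distrib]
    have := hasLead_sum (Finset.range (q.natDegree + 1))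
      (fun i => -(mono e (1, 0) *
        (algebraMap ℂ (HahnSeries Γ (Polynomial ℂ)) (q.coeff i) * mono e (0, 2) ^ i))) (e (0, 2)) (fun _ => 0) ?_
    · simpa only [Finset.sum_const_zero] using this
    · intro i _
      -- The difference is (1, 2i − 2), positive whatever the sign of 2i − 2; this is why `hx`
      -- ranges over all integers.
      have hlt : e (0, 2) < e ((1, 0) + i • (0, 2)) := by
        have : ((1, 0) + i • (0, 2) : (Fin n → ℤ) × ℤ) = ((0, 2) : (Fin n → ℤ) × ℤ) + ((1, i * 2 - 2) : (Fin n → ℤ) × ℤ) := by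
          ext <;> simp
        rw [this, map_add]
        exact lt_add_of_pos_right _ (hx _)
      rw [mul_left_comm, mono_pow, mono_mul, HahnSeries.algebraMap_apply]
      have h4 := (hasLead_single 0 (algebraMap ℂ (Polynomial ℂ) (q.coeff i))).mul
        (hasLead_mono e ((1, 0) + i • (0, 2)))
      rw [zero_add] at h4
      have h5 := (h4.of_lt hlt).neg
      rw [neg_zero] at h5
      exact h5
  have h4 := (hasLead_mono e (-2, 0)).mul ((h1.add h2).add h3)
  rw [← map_add] at h4
  simpa [laurentY, sub_eq_add_neg] using h4

/-- The exponent of the leading monomial of `x^a z^b y^k`. -/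
def monExp (m : (Fin n → ℕ) × ℕ × ℕ) : (Fin n → ℤ) × ℤ :=
  (fun i => m.1 i - 2 * m.2.2, m.2.1 + 2 * m.2.2)

/-- If k < k', the index with a'_i < 2 would give a_i = a'_i − 2(k' − k) < 0. So k = k', and the
other exponents follow. -/
theorem monExp_injOn {m m' : (Fin n → ℕ) × ℕ × ℕ} (hm : IsReducedExp m) (hm' : IsReducedExp m')
    (h : monExp m = monExp m') : m = m' := by
  obtain ⟨a, b, k⟩ := m
  obtain ⟨a', b', k'⟩ := m'
  simp only [monExp, Prod.mk.injEq] at h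
  obtain ⟨h1, h2⟩ := h
  have h1' : ∀ i, (a i : ℤ) - 2 * k = a' i - 2 * k' := fun i => congrFun h1 i
  simp only [IsReducedExp] at hm hm'
  have hk : k = k' := by
    rcases lt_trichotomy k k' with h | h | h
    · rcases hm' with h0 | ⟨i, hi⟩
      · omega
      · have := h1' i; omega
    · exact h
    · rcases hm with h0 | ⟨i, hi⟩
      · omega
      · have := h1' i; omega
  subst hk
  have ha : a = a' := funext fun i => by have := h1' i; omega
  have hb : b = b' := by omega
  rw [ha, hb]

include hz hx in
theorem hasLead_stdMon (m : (Fin n → ℕ) × ℕ × ℕ) :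
    HasLead (laurent e q (stdMon m)) (e (monExp m)) ((-1) ^ m.2.2) := by
  have h := ((hasLead_mono e (fun i => (m.1 i : ℤ), 0)).mul
    ((hasLead_mono e (0, 1)).pow m.2.1)).mul ((hasLead_laurentY e q hz hx).pow m.2.2)
  rw [← map_nsmul, ← map_nsmul, ← map_add, ← map_add] at h
  have h1 : laurent e q (stdMon m) = mono e (fun i => (m.1 i : ℤ), 0) * mono e (0, 1) ^ m.2.1 *
      laurentY e q ^ m.2.2 := by
    simp [stdMon, map_prod, prod_mono_pow]
  have h2 : monExp m = (fun i => (m.1 i : ℤ), 0) + m.2.1 • (0, 1) + m.2.2 • (-2, 2) := by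
    ext <;> simp [monExp] <;> ring
  rw [h1, h2]
  simpa using h

-- Distinct reduced monomials have distinct leading exponents, so the minimal one cannot cancel. The
-- minimality over the support is kept because it later bounds all the monomials.
include hz hx in
theorem exists_hasLead_redComb {c : {m : (Fin n → ℕ) × ℕ × ℕ // IsReducedExp m} →₀ Polynomial ℂ}
    (hc : c ≠ 0) : ∃ m ∈ c.support, (∃ r ≠ 0, HasLead (laurent e q (redComb n q c))
      (e (monExp m.1)) r) ∧ ∀ m' ∈ c.support, e (monExp m.1) ≤ e (monExp m'.1) := by
  classical
  obtain ⟨m, hm, hmin⟩ := c.support.exists_min_image (fun m => e (monExp m.1))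
    (Finsupp.support_nonempty_iff.2 hc)
  refine ⟨m, hm, ⟨c m * (-1) ^ m.1.2.2, mul_ne_zero (Finsupp.mem_support_iff.1 hm)
    (pow_ne_zero _ (neg_ne_zero.2 one_ne_zero)), ?_⟩, hmin⟩
  rw [redComb_apply, map_sum]
  have hl : ∀ m', HasLead (laurent e q (Polynomial.aeval (polyP n q) (c m') * stdMon m'.1))
      (e (monExp m'.1)) (c m' * (-1) ^ m'.1.2.2) := by
    intro m'
    rw [map_mul, laurent_aeval_polyP]
    simpa using (hasLead_single 0 (c m')).mul (hasLead_stdMon e q hz hx m'.1)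
  have h := hasLead_sum c.support
    (fun m' => laurent e q (Polynomial.aeval (polyP n q) (c m') * stdMon m'.1)) (e (monExp m.1))
    (fun m' => if m' = m then c m * (-1) ^ m.1.2.2 else 0) (by
      intro m' hm'
      by_cases heq : m' = m
      · subst heq; simpa using hl m'
      · rw [if_neg heq]
        refine (hl m').of_lt (lt_of_le_of_ne (hmin m' hm') fun h0 => heq ?_)
        exact Subtype.ext (monExp_injOn m'.2 m.2 (e.injective h0.symm)))
  rw [Finset.sum_ite_eq', if_pos hm] at h
  exact h

include hz hx in
theorem exists_hasLead {f : A} (hf : f ≠ 0) :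
    ∃ m : (Fin n → ℕ) × ℕ × ℕ, ∃ r ≠ 0, HasLead (laurent e q f) (e (monExp m)) r := by
  obtain ⟨c, rfl⟩ := redComb_surjective q f
  obtain ⟨m, -, h, -⟩ := exists_hasLead_redComb e q hz hx (c := c) (by rintro rfl; simp at hf)
  exact ⟨m.1, h⟩

end Laurent

end

/-! ### The parity argument on exponents. -/

noncomputable section

/-- The parity argument: the only additive weight compatible with a homogeneous locally nilpotent
derivation of degree `(d, t)` on the semigroup of leading exponents is the degree in `z`. -/
theorem weight_eq_zero_of_leading_exponents {n : ℕ} (ν : Fin n → ℕ) (m : ℕ) (d : Fin n → ℤ)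
    (t : ℤ) (hm : ∑ j, ν j ≤ m) (hd : ∑ j, d j * ν j + t * m = -1)
    (hx : ∀ j, ∃ a : (Fin n → ℕ) × ℕ × ℕ, monExp a = (ν j • d + Pi.single j 1, ν j * t))
    (hz : ∃ a : (Fin n → ℕ) × ℕ × ℕ, monExp a = (m • d, m * t + 1)) :
    (∀ j, ν j = 0) ∧ m = 1 := by
  -- For a = (a, b, k) the weight equals Σ a_j ν_j + m b + 2k(m − Σ ν_j), a sum of nonnegative
  -- terms; weight zero kills each of them.
  have key : ∀ a : (Fin n → ℕ) × ℕ × ℕ,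
      ∑ j, (monExp a).1 j * ν j + (monExp a).2 * m = 0 →
      m * a.2.1 = 0 ∧ a.2.2 * (m - ∑ j, ν j) = 0 := by
    intro a h
    have h1 : ∑ j, (monExp a).1 j * (ν j : ℤ) =
        ∑ j, (a.1 j * ν j : ℤ) - 2 * a.2.2 * ∑ j, (ν j : ℤ) := by
      rw [Finset.mul_sum, ← Finset.sum_sub_distrib]
      exact Finset.sum_congr rfl fun j _ => by simp only [monExp]; ring
    have h2 : (0 : ℤ) ≤ ∑ j, (a.1 j * ν j : ℤ) := Finset.sum_nonneg fun j _ => by positivity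
    have h3 : ((m - ∑ j, ν j : ℕ) : ℤ) = m - ∑ j, (ν j : ℤ) := by
      rw [Nat.cast_sub hm]; simp
    have h4 : (0 : ℤ) ≤ (m * a.2.1 : ℕ) := by positivity
    have h5 : (0 : ℤ) ≤ (a.2.2 * (m - ∑ j, ν j) : ℕ) := by positivity
    have h6 : ∑ j, (a.1 j * ν j : ℤ) + (m * a.2.1 : ℕ) +
        2 * (a.2.2 * (m - ∑ j, ν j) : ℕ) = 0 := by
      rw [← h, h1, Nat.cast_mul a.2.2, h3]
      simp only [monExp]
      push_cast
      ring
    constructor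
    · have : ((m * a.2.1 : ℕ) : ℤ) = 0 := by linarith
      exact_mod_cast this
    · have : ((a.2.2 * (m - ∑ j, ν j) : ℕ) : ℤ) = 0 := by linarith
      exact_mod_cast this
  have hx' : ∀ j, ∃ b k : ℕ, (ν j : ℤ) * t = b + 2 * k ∧ m * b = 0 ∧
      k * (m - ∑ j, ν j) = 0 := by
    intro j
    obtain ⟨a, ha⟩ := hx j
    have hsum : ∑ i, (Pi.single j 1 : Fin n → ℤ) i * ν i = ν j := by
      rw [Finset.sum_eq_single j (fun i _ hi => by simp [Pi.single_eq_of_ne hi]) (by simp)]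
      simp
    have h0 := key a (by
      rw [ha]
      have : ∑ i, (ν j • d + Pi.single j 1 : Fin n → ℤ) i * ν i =
          ν j * ∑ i, d i * ν i + ν j := by
        conv_rhs => rw [← hsum]
        rw [Finset.mul_sum, ← Finset.sum_add_distrib]
        refine Finset.sum_congr rfl fun i _ => ?_
        rw [hsum, Pi.add_apply, Pi.smul_apply, nsmul_eq_mul]
        ring
      rw [this]
      linear_combination (ν j : ℤ) * hd)
    refine ⟨a.2.1, a.2.2, ?_, h0.1, h0.2⟩
    have := congrArg Prod.snd ha
    simp only [monExp] at this
    exact this.symm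
  obtain ⟨b, k, hbk, hb, hk⟩ : ∃ b k : ℕ, (m : ℤ) * t + 1 = b + 2 * k ∧ m * b = 0 ∧
      k * (m - ∑ j, ν j) = 0 := by
    obtain ⟨a, ha⟩ := hz
    have h0 := key a (by
      rw [ha]
      have : ∑ i, (m • d : Fin n → ℤ) i * ν i = m * ∑ i, d i * ν i := by
        rw [Finset.mul_sum]
        refine Finset.sum_congr rfl fun i _ => ?_
        simp only [Pi.smul_apply, nsmul_eq_mul]
        ring
      rw [this]
      linear_combination (m : ℤ) * hd)
    refine ⟨a.2.1, a.2.2, ?_, h0.1, h0.2⟩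
    have := congrArg Prod.snd ha
    simp only [monExp] at this
    exact this.symm
  have hm0 : m ≠ 0 := by
    rintro rfl
    have hν : ∀ j, ν j = 0 := fun j => by
      have := Finset.single_le_sum (f := ν) (fun i _ => Nat.zero_le _) (Finset.mem_univ j)
      omega
    simp [hν] at hd
  have hb0 : b = 0 := by simpa [hm0] using hb
  subst hb0
  have hν : ∀ j, ν j = 0 := by
    by_contra hne
    push Not at hne
    obtain ⟨j, hj⟩ := hne
    -- If m = Σ ν_j, then mt + 1 = 2k makes m and t odd, while each ν_i t is even, so every ν_i and
    -- hence m is even. If m > Σ ν_j, all the k vanish, so ν_j t = 0 gives t = 0, against mt + 1 =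
    -- 0.
    by_cases hms : m - ∑ j, ν j = 0
    · have hms' : m = ∑ j, ν j := by omega
      have hodd : Odd ((m : ℤ) * t) := ⟨k - 1, by push_cast at hbk; linarith⟩
      rw [Int.odd_mul] at hodd
      have heven : Even (∑ j, (ν j : ℤ)) := by
        refine Finset.even_sum _ fun i _ => ?_
        obtain ⟨b', k', h1, h2, -⟩ := hx' i
        have hb' : b' = 0 := by simpa [hm0] using h2
        have : Even ((ν i : ℤ) * t) := ⟨k', by rw [h1, hb']; push_cast; ring⟩
        rcases Int.even_mul.1 this with h | h
        · exact h
        · exact absurd hodd.2 (Int.not_odd_iff_even.2 h)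
      have h7 : (m : ℤ) = ∑ j, (ν j : ℤ) := by rw [hms']; simp
      rw [← h7] at heven
      exact (Int.not_odd_iff_even.2 heven) hodd.1
    · have hk0 : k = 0 := by simpa [hms] using hk
      obtain ⟨b', k', h1, h2, h3⟩ := hx' j
      have hb' : b' = 0 := by simpa [hm0] using h2
      have hk' : k' = 0 := by simpa [hms] using h3
      subst hb' hk' hk0
      have ht : t = 0 := by
        have : (ν j : ℤ) * t = 0 := by simpa using h1
        simpa [hj] using this
      simp [ht] at hbk
  refine ⟨hν, ?_⟩
  have h8 : t * m = -1 := by simpa [hν] using hd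
  have : (m : ℤ) ∣ 1 := ⟨-t, by linarith⟩
  have := Int.eq_one_of_dvd_one (by positivity) this
  exact_mod_cast this

/-! ### The induced derivation and its leading symbol. -/

section Induced

variable {n : ℕ} {Γ : Type*} [AddCommGroup Γ] [LinearOrder Γ] [IsOrderedAddMonoid Γ]

local notation "A" => MvPolynomial (Fin (n + 2)) ℂ

variable (e : ((Fin n → ℤ) × ℤ) ≃+ Γ) (q : Polynomial ℂ) (E : Derivation ℂ (MvPolynomial (Fin (n + 2)) ℂ) (MvPolynomial (Fin (n + 2)) ℂ))

/-- The exponent of `x_j` (or of `z`, for `none`) as an additive character. -/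
def expChar (j : Option (Fin n)) : Γ →+ ℤ where
  toFun u := j.elim (e.symm u).2 fun i => (e.symm u).1 i
  map_zero' := by cases j <;> simp
  map_add' u v := by cases j <;> simp

@[simp] theorem expChar_some (i : Fin n) (u : (Fin n → ℤ) × ℤ) :
    expChar e (some i) (e u) = u.1 i := by simp [expChar]

@[simp] theorem expChar_none (u : (Fin n → ℤ) × ℤ) :
    expChar e none (e u) = u.2 := by simp [expChar]

/-- The logarithmic derivatives of the coordinates. -/
def logDer (j : Option (Fin n)) : HahnSeries Γ (Polynomial ℂ) :=
  Option.elim j (laurent e q (E (varz n)) * mono e (0, -1))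
    fun i => laurent e q (E (varx i)) * mono e (-Pi.single i 1, 0)

/-- The derivation induced by `E` on the Laurent algebra. -/
def inducedDer : Derivation ℂ (HahnSeries Γ (Polynomial ℂ)) (HahnSeries Γ (Polynomial ℂ)) :=
  ∑ j : Option (Fin n), logDer e q E j • eulerDer (expChar e j)

theorem inducedDer_apply (f : HahnSeries Γ (Polynomial ℂ)) :
    inducedDer e q E f = ∑ j, logDer e q E j * eulerDer (expChar e j) f := by
  classical
  have h : ∀ s : Finset (Option (Fin n)), (∑ j ∈ s, logDer e q E j • eulerDer (expChar e j)) f =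
      ∑ j ∈ s, logDer e q E j * eulerDer (expChar e j) f := by
    intro s
    induction s using Finset.induction_on with
    | empty => simp
    | insert j s hj ih =>
      rw [Finset.sum_insert hj, Finset.sum_insert hj, Derivation.add_apply, ih,
        Derivation.smul_apply, smul_eq_mul]
  exact h _

theorem eulerDer_mono (χ : Γ →+ ℤ) (u : (Fin n → ℤ) × ℤ) :
    eulerDer χ (mono e u) = (χ (e u) : HahnSeries Γ (Polynomial ℂ)) * mono e u := by
  ext1
  funext v
  rw [← zsmul_eq_mul, HahnSeries.coeff_smul, eulerDer_coeff, mono]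
  by_cases h : v = e u
  · rw [h]
  · rw [HahnSeries.coeff_single_of_ne h, smul_zero, smul_zero]

theorem eulerDer_C (χ : Γ →+ ℤ) (p : Polynomial ℂ) :
    eulerDer χ (HahnSeries.C p) = 0 := by
  ext1
  funext v
  rw [eulerDer_coeff]
  by_cases h : v = 0
  · simp [h]
  · change χ v • (HahnSeries.single 0 p).coeff v = _
    rw [HahnSeries.coeff_single_of_ne h, smul_zero]; rfl

theorem inducedDer_laurent_varx (i : Fin n) :
    inducedDer e q E (laurent e q (varx i)) = laurent e q (E (varx i)) := by
  rw [inducedDer_apply, Fintype.sum_option]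
  simp only [laurent_varx, eulerDer_mono, expChar_some, expChar_none]
  rw [Finset.sum_eq_single i (fun j _ hj => by simp [Pi.single_eq_of_ne hj]) (by simp)]
  simp only [logDer, Option.elim, Pi.single_eq_same, Int.cast_one, one_mul, Int.cast_zero, zero_mul,
    mul_zero, zero_add, mul_assoc, mono_mul]
  rw [show ((-Pi.single i 1, 0) + (Pi.single i 1, 0) : (Fin n → ℤ) × ℤ) = 0 by ext <;> simp,
    mono_zero, mul_one]

theorem inducedDer_laurent_varz :
    inducedDer e q E (laurent e q (varz n)) = laurent e q (E (varz n)) := by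
  rw [inducedDer_apply, Fintype.sum_option]
  simp only [laurent_varz, eulerDer_mono, expChar_some, expChar_none]
  simp only [logDer, Option.elim, Int.cast_one, one_mul, Pi.zero_apply, Int.cast_zero, zero_mul,
    mul_zero, Finset.sum_const_zero, add_zero, mul_assoc, mono_mul]
  rw [show ((0, -1) + (0, 1) : (Fin n → ℤ) × ℤ) = 0 by ext <;> simp, mono_zero, mul_one]

/-- The elements where both sides agree form a subalgebra containing the x_i, z and P, hence x²y.
The nonzero factor x² can be cancelled by the Leibniz rule, so y belongs to it too. -/
theorem inducedDer_laurent (hE : E (polyP n q) = 0) (f : A) :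
    inducedDer e q E (laurent e q f) = laurent e q (E f) := by
  let S : Subalgebra ℂ A :=
    { carrier := {f | inducedDer e q E (laurent e q f) = laurent e q (E f)}
      mul_mem' := fun {f g} hf hg => by
        simp only [Set.mem_ofPred_eq] at hf hg ⊢
        simp only [map_mul, Derivation.leibniz, hf, hg, smul_eq_mul, map_add]
      add_mem' := fun {f g} hf hg => by
        simp only [Set.mem_ofPred_eq] at hf hg ⊢
        simp only [map_add, hf, hg]
      algebraMap_mem' := fun r => by
        simp only [Set.mem_ofPred_eq, AlgHom.commutes, Derivation.map_algebraMap, map_zero] }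
  have hx : ∀ i : Fin n, varx i ∈ S := inducedDer_laurent_varx e q E
  have hz : varz n ∈ S := inducedDer_laurent_varz e q E
  have hP : polyP n q ∈ S := by
    change inducedDer e q E (laurent e q (polyP n q)) = laurent e q (E (polyP n q))
    rw [hE, map_zero, laurent_polyP, inducedDer_apply]
    exact Finset.sum_eq_zero fun j _ => by rw [eulerDer_C, mul_zero]
  have hxi : xprod n ∈ S := prod_mem fun i _ => hx i
  have hy : xprod n ^ 2 * vary n ∈ S := by
    have : xprod n ^ 2 * vary n = polyP n q - varz n ^ 2 -
        xprod n * Polynomial.aeval (varz n ^ 2) q := by rw [polyP_eq]; ring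
    rw [this]
    exact sub_mem (sub_mem hP (pow_mem hz 2)) (mul_mem hxi
      (Algebra.adjoin_le (Set.singleton_subset_iff.2 (pow_mem hz 2))
        (Polynomial.aeval_mem_adjoin_singleton ℂ _)))
  have hy' : vary n ∈ S := by
    have h1 : inducedDer e q E (laurent e q (xprod n ^ 2 * vary n)) =
      laurent e q (E (xprod n ^ 2 * vary n)) := hy
    have h2 : inducedDer e q E (laurent e q (xprod n ^ 2)) =
      laurent e q (E (xprod n ^ 2)) := pow_mem hxi 2
    rw [map_mul, Derivation.leibniz, Derivation.leibniz, map_add, h2] at h1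
    simp only [smul_eq_mul, map_mul (laurent e q)] at h1
    have h3 := add_right_cancel h1
    have h4 : laurent e q (xprod n ^ 2) ≠ 0 := by
      rw [map_pow, laurent_xprod]; exact pow_ne_zero _ (mono_ne_zero _ _)
    exact mul_left_cancel₀ h4 h3
  have : f ∈ S := by rw [subalgebra_eq_top hx hy' hz]; exact Algebra.mem_top
  exact this

/-- The symbol of the leading part, of degree `d`, of the induced derivation. -/
def symbol (d : Γ) : Γ →+ Polynomial ℂ :=
  ∑ j : Option (Fin n), ((AddMonoidHom.mulLeft ((logDer e q E j).coeff d)).comp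
    (Int.castAddHom (Polynomial ℂ))).comp (expChar e j)

theorem symbol_apply (d u : Γ) :
    symbol e q E d u = ∑ j, (logDer e q E j).coeff d * (expChar e j u : Polynomial ℂ) := by
  simp [symbol, AddMonoidHom.finsetSum_apply]

theorem symbol_x (d : Γ) (i : Fin n) :
    symbol e q E d (e (Pi.single i 1, 0)) = (logDer e q E (some i)).coeff d := by
  rw [symbol_apply, Fintype.sum_option]
  simp only [expChar_some, expChar_none]
  rw [Finset.sum_eq_single i (fun j _ hj => by simp [Pi.single_eq_of_ne hj]) (by simp)]
  simp

theorem symbol_z (d : Γ) :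
    symbol e q E d (e (0, 1)) = (logDer e q E none).coeff d := by
  rw [symbol_apply, Fintype.sum_option]
  simp

theorem symbol_eq (d u : Γ) : symbol e q E d u = (expChar e none u) • symbol e q E d (e (0, 1)) +
    ∑ i, (expChar e (some i) u) • symbol e q E d (e (Pi.single i 1, 0)) := by
  simp only [symbol_x, symbol_z]
  rw [symbol_apply, Fintype.sum_option]
  simp only [zsmul_eq_mul, mul_comm]

variable {e q E}

theorem HasLead.inducedDer {d : Γ} (hd : ∀ j, ∀ v < d, (logDer e q E j).coeff v = 0)
    {f : HahnSeries Γ (Polynomial ℂ)} {u : Γ} {c : Polynomial ℂ} (hf : HasLead f u c) :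
    HasLead (inducedDer e q E f) (d + u) (symbol e q E d u * c) := by
  have hj : ∀ j, HasLead (logDer e q E j) d ((logDer e q E j).coeff d) := fun j => ⟨hd j, rfl⟩
  have := hasLead_sum Finset.univ (fun j => logDer e q E j * _root_.eulerDer (expChar e j) f) (d + u)
    (fun j => (logDer e q E j).coeff d * (expChar e j u • c))
    (fun j _ => (hj j).mul (hf.eulerDer (expChar e j)))
  rw [inducedDer_apply, symbol_apply, Finset.sum_mul]
  simpa only [zsmul_eq_mul, mul_assoc] using this

theorem HasLead.iterate (hP : E (polyP n q) = 0) {d : Γ}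
    (hd : ∀ j, ∀ v < d, (logDer e q E j).coeff v = 0)
    {f : A} {u : Γ} {c : Polynomial ℂ} (hf : HasLead (laurent e q f) u c) (k : ℕ) :
    HasLead (laurent e q (E^[k] f)) (k • d + u)
      ((∏ i ∈ Finset.range k, symbol e q E d (i • d + u)) * c) := by
  induction k with
  | zero => simpa using hf
  | succ k ih =>
    rw [Function.iterate_succ_apply', ← inducedDer_laurent e q E hP, Finset.prod_range_succ,
      succ_nsmul', add_assoc]
    have := ih.inducedDer hd
    rwa [← mul_assoc, mul_comm (symbol e q E d _)] at this

/-- The k-th iterate has the coefficient c ∏_{i<k} L(i d + u) at k d + u, L being the symbol.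
Nilpotency forces a factor to vanish; up to the first j with L(j d + u) = 0 these are true leading
terms, so j d + u is a leading exponent of a polynomial. -/
theorem exists_symbol_eq (hz : e (0, 1) < 0) (hx : ∀ k : ℤ, 0 < e (1, k))
    (hP : E (polyP n q) = 0) (hE : LocallyNilpotent E) {d : Γ}
    (hd : ∀ j, ∀ v < d, (logDer e q E j).coeff v = 0)
    {f : A} {u : Γ} {c : Polynomial ℂ} (hc : c ≠ 0) (hf : HasLead (laurent e q f) u c) :
    ∃ j : ℕ, symbol e q E d u + j • symbol e q E d d = 0 ∧
      ∃ m : (Fin n → ℕ) × ℕ × ℕ, e (monExp m) = j • d + u := by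
  classical
  have hex : ∃ j : ℕ, symbol e q E d (j • d + u) = 0 := by
    by_contra hne
    push Not at hne
    obtain ⟨k, hk⟩ := hE f
    have h1 := hf.iterate hP hd k
    rw [hk, map_zero] at h1
    exact h1.ne_zero (mul_ne_zero (Finset.prod_ne_zero_iff.2 fun i _ => hne i) hc) rfl
  refine ⟨Nat.find hex, ?_, ?_⟩
  · have := Nat.find_spec hex
    rwa [map_add, map_nsmul, add_comm] at this
  · have h1 := hf.iterate hP hd (Nat.find hex)
    have hne : (∏ i ∈ Finset.range (Nat.find hex), symbol e q E d (i • d + u)) * c ≠ 0 :=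
      mul_ne_zero (Finset.prod_ne_zero_iff.2 fun i hi =>
        Nat.find_min hex (Finset.mem_range.1 hi)) hc
    obtain ⟨m, r, hr, hm⟩ := exists_hasLead e q hz hx (f := E^[Nat.find hex] f) (by
      intro h0
      rw [h0, map_zero] at h1
      exact h1.ne_zero hne rfl)
    exact ⟨m, hm.unique h1 hr hne⟩

theorem exists_common_lead {ι : Type*} [Fintype ι] (θ : ι → HahnSeries Γ (Polynomial ℂ))
    (h : ∃ i, θ i ≠ 0) :
    ∃ d, (∀ i, ∀ v < d, (θ i).coeff v = 0) ∧ ∃ i, (θ i).coeff d ≠ 0 := by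
  classical
  obtain ⟨i, hi⟩ := h
  obtain ⟨k, hk, hmin⟩ := (Finset.univ.filter fun i => θ i ≠ 0).exists_min_image
    (fun i => (θ i).order) ⟨i, by simpa using hi⟩
  refine ⟨(θ k).order, fun i v hv => ?_, k, ?_⟩
  · by_cases h0 : θ i = 0
    · simp [h0]
    · exact HahnSeries.coeff_eq_zero_of_lt_order (hv.trans_le (hmin i (by simpa using h0)))
  · rw [Ne, HahnSeries.coeff_order_eq_zero]
    simpa using hk

theorem laurent_eq_zero_iff (hz : e (0, 1) < 0) (hx : ∀ k : ℤ, 0 < e (1, k)) {f : A} :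
    laurent e q f = 0 ↔ f = 0 := by
  refine ⟨fun h => ?_, fun h => by rw [h, map_zero]⟩
  by_contra hne
  obtain ⟨m, r, hr, hm⟩ := exists_hasLead e q hz hx hne
  exact hm.ne_zero hr h

theorem exists_logDer_ne_zero (hz : e (0, 1) < 0) (hx : ∀ k : ℤ, 0 < e (1, k))
    (hP : E (polyP n q) = 0) (hE : E ≠ 0) : ∃ j, logDer e q E j ≠ 0 := by
  by_contra hne
  push Not at hne
  have h1 : ∀ i : Fin n, E (varx i) = 0 := fun i => by
    have := hne (some i)
    simpa [logDer, mono_ne_zero, laurent_eq_zero_iff hz hx] using this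
  have h2 : E (varz n) = 0 := by
    have := hne none
    simpa [logDer, mono_ne_zero, laurent_eq_zero_iff hz hx] using this
  rw [E.map_polyP q h1, h2, mul_zero, add_zero] at hP
  exact hE (derivation_ext_var h1 (by simpa [xprod_ne_zero] using hP) h2)

/-- The leading monomial of an element of the kernel of a locally nilpotent derivation annihilating
`polyP n q` only involves the `x_i`. -/
theorem exists_hasLead_of_apply_eq_zero (hz : e (0, 1) < 0) (hx : ∀ k : ℤ, 0 < e (1, k))
    (hP : E (polyP n q) = 0) (hE : LocallyNilpotent E) (hE0 : E ≠ 0) {f : A} (hf : f ≠ 0)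
    (hEf : E f = 0) :
    ∃ a : Fin n → ℕ, ∃ r ≠ 0, HasLead (laurent e q f) (e (fun i => (a i : ℤ), 0)) r := by
  obtain ⟨d, hd, j₀, hj₀⟩ := exists_common_lead (logDer e q E) (exists_logDer_ne_zero hz hx hP hE0)
  set L := symbol e q E d with hL
  have hlead : ∀ {f : A} {u : Γ} {c : Polynomial ℂ}, c ≠ 0 → HasLead (laurent e q f) u c →
      ∃ j : ℕ, L u + j • L d = 0 ∧ ∃ m : (Fin n → ℕ) × ℕ × ℕ, e (monExp m) = j • d + u :=
    fun hc hf => exists_symbol_eq hz hx hP hE hd hc hf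
  have hX : ∀ i : Fin n, _ := fun i => hlead one_ne_zero (f := varx i)
    (by rw [laurent_varx]; exact hasLead_mono e _)
  obtain ⟨m, hm, az, haz⟩ := hlead one_ne_zero (f := varz n)
    (by rw [laurent_varz]; exact hasLead_mono e _)
  obtain ⟨r, hr, -⟩ := hlead (neg_ne_zero.2 one_ne_zero) (f := vary n)
    (by rw [laurent_vary]; exact hasLead_laurentY e q hz hx)
  choose ν hν ax hax using hX
  have hLeq : ∀ u : (Fin n → ℤ) × ℤ, L (e u) = u.2 • L (e (0, 1)) +
      ∑ i, u.1 i • L (e (Pi.single i 1, 0)) := fun u => by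
    rw [hL, symbol_eq]; simp only [expChar_some, expChar_none]
  have hLz : L (e (0, 1)) = -(m • L d) := eq_neg_of_add_eq_zero_left hm
  have hLx : ∀ i, L (e (Pi.single i 1, 0)) = -(ν i • L d) :=
    fun i => eq_neg_of_add_eq_zero_left (hν i)
  have hLu : ∀ u : (Fin n → ℤ) × ℤ, L (e u) =
      ((-(u.2 * m + ∑ i, u.1 i * ν i) : ℤ) : Polynomial ℂ) * L d := fun u => by
    rw [hLeq, hLz]
    simp only [hLx, zsmul_eq_mul, nsmul_eq_mul]
    push_cast
    rw [neg_add, add_mul, ← Finset.sum_neg_distrib, Finset.sum_mul]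
    congr 1
    · ring
    · exact Finset.sum_congr rfl fun i _ => by ring
  -- Otherwise L would vanish on all the x_i and on z, whereas `j₀` was chosen with a nonzero
  -- coefficient in degree d.
  have hLd : L d ≠ 0 := by
    intro h0
    apply hj₀
    cases j₀ with
    | none => rw [← symbol_z, ← hL, hLz, h0, smul_zero, neg_zero]
    | some i => rw [← symbol_x, ← hL, hLx, h0, smul_zero, neg_zero]
  obtain ⟨u, rfl⟩ := e.surjective d
  have hcancel : ∀ k l : ℤ, (k : Polynomial ℂ) * L (e u) = l * L (e u) → k = l := fun k l h => by
    exact_mod_cast mul_right_cancel₀ hLd h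
  -- Evaluate `hLu` at d itself and cancel L(d).
  have hd1 : ∑ i, u.1 i * ν i + u.2 * m = -1 := by
    have := hcancel 1 (-(u.2 * m + ∑ i, u.1 i * ν i)) (by rw [Int.cast_one, one_mul, ← hLu u])
    linarith
  -- The leading exponent (−2, 2) of y gives 2 Σ ν_j − 2m = −r with r ≥ 0.
  have hsum : ∑ j, ν j ≤ m := by
    have h1 := hLu (-2, 2)
    rw [eq_neg_of_add_eq_zero_left hr] at h1
    have := hcancel (-r) _ (by rw [← h1]; simp)
    have h2 : ∑ i, (-2 : Fin n → ℤ) i * (ν i : ℤ) = -2 * ∑ i, (ν i : ℤ) := by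
      rw [Finset.mul_sum]; rfl
    simp only [h2] at this
    have h3 : (∑ j, (ν j : ℤ)) ≤ m := by linarith [Int.natCast_nonneg r]
    exact_mod_cast h3
  obtain ⟨hν0, hm1⟩ := weight_eq_zero_of_leading_exponents ν m u.1 u.2 hsum hd1
    (fun j => ⟨ax j, e.injective (by
      rw [hax j, ← map_nsmul, ← map_add]; congr 1; ext <;> simp)⟩)
    ⟨az, e.injective (by
      rw [haz, ← map_nsmul, ← map_add]; congr 1; ext <;> simp)⟩
  obtain ⟨a, c, hc, ha⟩ := exists_hasLead e q hz hx hf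
  have h1 := ha.inducedDer hd
  rw [inducedDer_laurent e q E hP, hEf, map_zero] at h1
  -- As E f = 0, the symbol vanishes at the leading exponent of f. With ν = 0 and m = 1 this says b
  -- + 2k = 0 there, so b = k = 0.
  have h2 : L (e (monExp a)) = 0 := by
    by_contra hne
    exact h1.ne_zero (mul_ne_zero hne hc) rfl
  rw [hLu, hm1] at h2
  simp only [hν0] at h2
  have h3 := Int.cast_eq_zero.1 ((mul_eq_zero.1 h2).resolve_right hLd)
  simp [monExp] at h3
  refine ⟨a.1, c, hc, ?_⟩
  have h4 : monExp a = (fun i => (a.1 i : ℤ), 0) := by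
    have h5 : a.2.1 = 0 := by omega
    have h6 : a.2.2 = 0 := by omega
    simp [monExp, h5, h6]
  rwa [h4] at ha

end Induced

end

/-! ### Lexicographic orders with a chosen x_i first. -/

noncomputable section

section Order

variable {n : ℕ}

/-- The lattice of exponents, ordered lexicographically starting with the exponent of `x_{i₀}` and
ending with the opposite of the exponent of `z`. -/
def lexEquiv (i₀ : Fin n) : ((Fin n → ℤ) × ℤ) ≃+ Lex (Lex (Fin n → ℤ) × ℤ) where
  toFun u := toLex (toLex (fun j => u.1 (Equiv.swap i₀ ⟨0, i₀.pos⟩ j)), -u.2)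
  invFun v := (fun j => ofLex (ofLex v).1 (Equiv.swap i₀ ⟨0, i₀.pos⟩ j), -(ofLex v).2)
  left_inv u := by ext <;> simp
  right_inv v := by
    refine congrArg toLex (Prod.ext (funext fun j => ?_) (neg_neg _))
    exact congrArg (ofLex (ofLex v).1) (Equiv.swap_apply_self i₀ ⟨0, i₀.pos⟩ j)
  map_add' u v := congrArg toLex (Prod.ext rfl (neg_add _ _))

theorem lexEquiv_z (i₀ : Fin n) : lexEquiv i₀ (0, 1) < 0 := by
  exact Prod.Lex.toLex_lt_toLex.2 (Or.inr ⟨rfl, (by norm_num : (-1 : ℤ) < 0)⟩)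

theorem lexEquiv_x (i₀ : Fin n) (k : ℤ) : 0 < lexEquiv i₀ (1, k) := by
  refine Prod.Lex.toLex_lt_toLex.2 (Or.inl (Pi.toLex_strictMono ?_))
  have : Nonempty (Fin n) := ⟨i₀⟩
  exact (zero_lt_one : (0 : Fin n → ℤ) < 1)

theorem le_of_lexEquiv_le {i₀ : Fin n} {u v : (Fin n → ℤ) × ℤ}
    (h : lexEquiv i₀ u ≤ lexEquiv i₀ v) : u.1 i₀ ≤ v.1 i₀ := by
  have h1 := (Prod.Lex.toLex_le_toLex'.1 h).1
  have h2 := Pi.apply_le_of_toLex (i := (⟨0, i₀.pos⟩ : Fin n)) h1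
    (fun j hj => absurd hj (by simp [Fin.lt_def]))
  simpa using h2

end Order

/-! ### Kernels of locally nilpotent derivations killing P. -/

section Kernel

variable {n : ℕ}

local notation "A" => MvPolynomial (Fin (n + 2)) ℂ

variable {q : Polynomial ℂ}
  {E : Derivation ℂ (MvPolynomial (Fin (n + 2)) ℂ) (MvPolynomial (Fin (n + 2)) ℂ)}

/-- With x_{i₀} first in the order, the leading monomial has the least exponent of x_{i₀} among the
leading monomials of all terms; being a monomial in the x_i, it has nonnegative exponents. -/
theorem exists_lead_le (hP : E (polyP n q) = 0) (hE : LocallyNilpotent E) (hE0 : E ≠ 0)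
    {c : {m : (Fin n → ℕ) × ℕ × ℕ // IsReducedExp m} →₀ Polynomial ℂ} (hc : c ≠ 0)
    (hEc : E (redComb n q c) = 0) (i₀ : Fin n) :
    ∃ a : Fin n → ℕ, (∃ r ≠ 0, HasLead (laurent (lexEquiv i₀) q (redComb n q c))
      (lexEquiv i₀ (fun i => (a i : ℤ), 0)) r) ∧
      ∀ m ∈ c.support, (a i₀ : ℤ) + 2 * m.1.2.2 ≤ m.1.1 i₀ := by
  obtain ⟨m, -, ⟨r, hr, hm⟩, hmin⟩ :=
    exists_hasLead_redComb (lexEquiv i₀) q (lexEquiv_z i₀) (lexEquiv_x i₀) hc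
  obtain ⟨a, s, hs, ha⟩ := exists_hasLead_of_apply_eq_zero (lexEquiv_z i₀) (lexEquiv_x i₀) hP hE hE0
    (f := redComb n q c) (by intro h0; rw [h0, map_zero] at hm; exact hm.ne_zero hr rfl) hEc
  refine ⟨a, ⟨s, hs, ha⟩, fun m' hm' => ?_⟩
  have h1 := hmin m' hm'
  rw [hm.unique ha hr hs] at h1
  have h2 := le_of_lexEquiv_le h1
  simp only [monExp] at h2
  linarith

/-- The substitution of `polyP n q` for `y`. -/
def substP (n : ℕ) (q : Polynomial ℂ) :
    MvPolynomial (Fin (n + 2)) ℂ →ₐ[ℂ] MvPolynomial (Fin (n + 2)) ℂ :=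
  subst varx (polyP n q) (varz n)

@[simp] theorem substP_varx (i : Fin n) : substP n q (varx i) = varx i := subst_varx _ _ _ _
@[simp] theorem substP_vary : substP n q (vary n) = polyP n q := subst_vary _ _ _
@[simp] theorem substP_varz : substP n q (varz n) = varz n := subst_varz _ _ _

/-- A reduced monomial with k > 0 has some a_i < 2, hence a_i − 2k < 0, which `exists_lead_le`
excludes when x_i comes first. So y enters only through P. -/
theorem exists_substP_eq (hP : E (polyP n q) = 0) (hE : LocallyNilpotent E)
    (hE0 : E ≠ 0) {f : A} (hEf : E f = 0) : ∃ g, substP n q g = f := by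
  obtain ⟨c, rfl⟩ := redComb_surjective q f
  by_cases hc : c = 0
  · exact ⟨0, by simp [hc]⟩
  change redComb n q c ∈ (substP n q).range
  rw [redComb_apply]
  refine sum_mem fun m hm => mul_mem ⟨Polynomial.aeval (vary n) (c m), ?_⟩ ⟨stdMon m.1, ?_⟩
  · simp [← Polynomial.aeval_algHom_apply]
  · have hk : m.1.2.2 = 0 := by
      rcases m.2 with h | ⟨i, hi⟩
      · exact h
      · obtain ⟨a, -, ha⟩ := exists_lead_le hP hE hE0 hc hEf i
        have := ha m hm
        omega
    simp [stdMon, hk]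

-- On ℂ[x_1,…,x_n,z,P] the embedding produces no negative exponents, since P becomes a coefficient.
variable (q) in
theorem laurent_substP_coeff (i₀ : Fin n) (g : A) (u : (Fin n → ℤ) × ℤ)
    (h : (laurent (lexEquiv i₀) q (substP n q g)).coeff (lexEquiv i₀ u) ≠ 0) :
    (∀ i, 0 ≤ u.1 i) ∧ 0 ≤ u.2 := by
  induction g using MvPolynomial.induction_on generalizing u with
  | C a =>
    have h1 : laurent (lexEquiv i₀) q (substP n q (C a)) =
        HahnSeries.single 0 (algebraMap ℂ (Polynomial ℂ) a) := by
      rw [← algebraMap_eq, AlgHom.commutes, AlgHom.commutes, HahnSeries.algebraMap_apply]; rfl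
    rw [h1] at h
    have h2 : lexEquiv i₀ u = 0 := by
      by_contra hne
      exact h (HahnSeries.coeff_single_of_ne hne)
    have h3 : u = 0 := by simpa using h2
    simp [h3]
  | add f g hf hg =>
    rw [map_add, map_add, HahnSeries.coeff_add] at h
    by_cases h0 : (laurent (lexEquiv i₀) q (substP n q f)).coeff (lexEquiv i₀ u) = 0
    · rw [h0, zero_add] at h; exact hg u h
    · exact hf u h0
  | mul_X f i hf =>
    have key : ∀ v : (Fin n → ℤ) × ℤ, (∀ i, 0 ≤ v.1 i) → 0 ≤ v.2 → ∀ p : Polynomial ℂ,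
        (laurent (lexEquiv i₀) q (substP n q f) *
          HahnSeries.single (lexEquiv i₀ v) p).coeff (lexEquiv i₀ u) ≠ 0 →
        (∀ i, 0 ≤ u.1 i) ∧ 0 ≤ u.2 := by
      intro v hv1 hv2 p hne
      rw [HahnSeries.coeff_mul_single, ← map_sub] at hne
      obtain ⟨h1, h2⟩ := hf _ (left_ne_zero_of_mul hne)
      refine ⟨fun i => ?_, ?_⟩
      · have := h1 i
        have := hv1 i
        simp only [Prod.fst_sub, Pi.sub_apply] at *
        omega
      · simp only [Prod.snd_sub] at h2
        omega
    rw [map_mul, map_mul] at h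
    revert i
    refine forall_var (p := fun t => (laurent (lexEquiv i₀) q (substP n q f) *
      laurent (lexEquiv i₀) q (substP n q t)).coeff (lexEquiv i₀ u) ≠ 0 →
        (∀ i, 0 ≤ u.1 i) ∧ 0 ≤ u.2) (fun i h => ?_) (fun h => ?_) (fun h => ?_)
    · rw [substP_varx, laurent_varx] at h
      refine key (Pi.single i 1, 0) (fun j => ?_) le_rfl 1 h
      exact (Pi.single_nonneg.2 zero_le_one : (0 : Fin n → ℤ) ≤ Pi.single i 1) j
    · rw [substP_vary, laurent_polyP] at h
      refine key 0 (fun _ => le_rfl) le_rfl Polynomial.X ?_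
      rwa [map_zero]
    · rw [substP_varz, laurent_varz] at h
      exact key (0, 1) (fun _ => le_rfl) zero_le_one 1 h

/-- The substitution of `0` for `x_{i₀}` and `z`, the free slot being used for `y`. -/
def zeroXZ (i₀ : Fin n) : MvPolynomial (Fin (n + 2)) ℂ →ₐ[ℂ] MvPolynomial (Fin n) ℂ :=
  subst (fun j => if j = i₀ then 0 else X j) (X i₀) 0

theorem exists_of_zeroXZ_eq_zero {i₀ : Fin n} {g : A} (h : zeroXZ i₀ g = 0) :
    ∃ a b, g = a * varx i₀ + b * varz n := by
  let s : MvPolynomial (Fin n) ℂ →ₐ[ℂ] A := aeval fun j => if j = i₀ then vary n else varx j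
  let I : Ideal A := Ideal.span {varx i₀, varz n}
  have hI : (Ideal.Quotient.mkₐ ℂ I).comp (s.comp (zeroXZ i₀)) = Ideal.Quotient.mkₐ ℂ I := by
    refine algHom_ext_var (fun j => ?_) ?_ ?_
    · simp only [AlgHom.comp_apply, zeroXZ, subst_varx]
      split_ifs with hj
      · subst hj
        rw [map_zero, map_zero, Ideal.Quotient.mkₐ_eq_mk]
        exact (Ideal.Quotient.eq_zero_iff_mem.2 (Ideal.subset_span (by simp))).symm
      · simp [s, hj]
    · simp [s, zeroXZ]
    · simp only [AlgHom.comp_apply, zeroXZ, subst_varz]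
      rw [map_zero, map_zero, Ideal.Quotient.mkₐ_eq_mk]
      exact (Ideal.Quotient.eq_zero_iff_mem.2 (Ideal.subset_span (by simp))).symm
  have h1 := DFunLike.congr_fun hI g
  rw [AlgHom.comp_apply, AlgHom.comp_apply, h, map_zero, map_zero, Ideal.Quotient.mkₐ_eq_mk] at h1
  obtain ⟨a, b, hab⟩ := Ideal.mem_span_pair.1 (Ideal.Quotient.eq_zero_iff_mem.1 h1.symm)
  exact ⟨a, b, hab.symm⟩

theorem varx_dvd_redComb {c : {m : (Fin n → ℕ) × ℕ × ℕ // IsReducedExp m} →₀ Polynomial ℂ}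
    {i : Fin n} (h : ∀ m ∈ c.support, m.1.1 i ≠ 0) : varx i ∣ redComb n q c := by
  rw [redComb_apply]
  refine Finset.dvd_sum fun m hm => Dvd.dvd.mul_left ?_ _
  have h1 : (varx i : A) ∣ varx i ^ m.1.1 i := dvd_pow_self _ (h m hm)
  have h2 : (varx i : A) ∣ ∏ j, varx j ^ m.1.1 j :=
    h1.trans (Finset.dvd_prod_of_mem (fun j => (varx j : A) ^ m.1.1 j) (Finset.mem_univ i))
  exact (h2.mul_right _).mul_right _

theorem not_injective_of_card_lt {n : ℕ}
    (h : MvPolynomial (Option (Fin n)) ℂ →ₐ[ℂ] MvPolynomial (Fin n) ℂ) :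
    ¬ Function.Injective h := by
  intro hinj
  have := trdeg_le_of_injective h hinj
  rw [MvPolynomial.trdeg_of_isDomain, MvPolynomial.trdeg_of_isDomain] at this
  simp only [Cardinal.mk_fintype, Fintype.card_option, Fintype.card_fin, Cardinal.lift_natCast,
    Nat.cast_le] at this
  omega

/-- A locally nilpotent derivation that annihilates `polyP n q` and whose kernel contains a
polynomial ring in `n + 1` variables annihilates all `x_i`. -/
theorem apply_varx_eq_zero (hP : E (polyP n q) = 0) (hE : LocallyNilpotent E)
    (κ : MvPolynomial (Option (Fin n)) ℂ →ₐ[ℂ] A) (hκ : Function.Injective κ)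
    (hEκ : ∀ p, E (κ p) = 0) (i₀ : Fin n) : E (varx i₀) = 0 := by
  by_cases hE0 : E = 0
  · simp [hE0]
  choose g hg using fun j => exists_substP_eq hP hE hE0 (hEκ (X j))
  have hθ : (substP n q).comp (aeval g) = κ := MvPolynomial.algHom_ext fun j => by
    rw [AlgHom.comp_apply, aeval_X, hg]
  -- Modulo x_{i₀} and z, the n+1 kernel elements live in a polynomial ring in n variables, so they
  -- satisfy a nontrivial relation there.
  obtain ⟨p, hp, hp0⟩ : ∃ p, ((zeroXZ i₀).comp (aeval g)) p = 0 ∧ p ≠ 0 := by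
    have := not_injective_of_card_lt ((zeroXZ i₀).comp (aeval g))
    rw [injective_iff_map_eq_zero] at this
    push Not at this
    exact this
  obtain ⟨a, b, hab⟩ := exists_of_zeroXZ_eq_zero hp
  have hf0 : κ p ≠ 0 := fun h0 => hp0 (hκ (by rw [h0, map_zero]))
  have hfab : κ p = substP n q (a * varx i₀ + b * varz n) := by rw [← hab, ← hθ]; rfl
  obtain ⟨c, hc⟩ := redComb_surjective q (κ p)
  have hc0 : c ≠ 0 := by
    rintro rfl
    exact hf0 (by rw [← hc, map_zero])
  obtain ⟨α, ⟨r, hr, hlead⟩, hle⟩ := exists_lead_le hP hE hE0 hc0 (by rw [hc]; exact hEκ p) i₀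
  -- The leading monomial involves only the x_i. Without x_{i₀} it could occur neither in a multiple
  -- of x_{i₀} nor in a multiple of z, all exponents being nonnegative.
  have hα : α i₀ ≠ 0 := by
    intro h0
    apply hr
    rw [← hlead.2, hc, hfab, map_add, map_add, map_mul, map_mul, map_mul, map_mul, substP_varx,
      substP_varz, laurent_varx, laurent_varz, HahnSeries.coeff_add, mono, mono,
      HahnSeries.coeff_mul_single, HahnSeries.coeff_mul_single, ← map_sub, ← map_sub]
    have h1 : (laurent (lexEquiv i₀) q (substP n q a)).coeff (lexEquiv i₀
        ((fun i => (α i : ℤ), 0) - (Pi.single i₀ 1, 0))) = 0 := by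
      by_contra hne
      have := (laurent_substP_coeff q i₀ a _ hne).1 i₀
      simp [h0] at this
    have h2 : (laurent (lexEquiv i₀) q (substP n q b)).coeff (lexEquiv i₀
        ((fun i => (α i : ℤ), 0) - (0, 1))) = 0 := by
      by_contra hne
      have := (laurent_substP_coeff q i₀ b _ hne).2
      simp at this
    rw [h1, h2, zero_mul, add_zero]
  have hdvd : varx i₀ ∣ κ p := by
    rw [← hc]
    exact varx_dvd_redComb fun m hm => by
      have := hle m hm
      omega
  obtain ⟨f, hf⟩ := hdvd
  refine hE.eq_zero_of_mul (varx_ne_zero i₀) (g := f) ?_ ?_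
  · rintro rfl
    exact hf0 (by rw [hf, mul_zero])
  · rw [← hf]; exact hEκ p

end Kernel

end

/-! ### Rigidity of automorphisms. -/

noncomputable section

section Rigidity

variable {n : ℕ}

local notation "A" => MvPolynomial (Fin (n + 2)) ℂ

theorem varx_prime (i : Fin n) : Prime (varx i : A) := MvPolynomial.X_prime

theorem eq_of_varx_dvd {i j : Fin n} (h : (varx i : A) ∣ varx j) : i = j := by
  by_contra hne
  obtain ⟨g, hg⟩ := h
  have := congrArg (subst (fun k => if k = i then 0 else 1) 0 0 : A →ₐ[ℂ] ℂ) hg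
  simp [Ne.symm hne] at this

/-- The polynomial ring in `x_1, …, x_n` and `P`. -/
def baseRing (n : ℕ) (q : Polynomial ℂ) :
    MvPolynomial (Option (Fin n)) ℂ →ₐ[ℂ] MvPolynomial (Fin (n + 2)) ℂ :=
  aeval fun o => o.elim (polyP n q) varx

/-- Setting z = 0 and solving P_q = P for y over the fraction field recovers the x_i and P. -/
theorem baseRing_injective (q : Polynomial ℂ) : Function.Injective (baseRing n q) := by
  let R := MvPolynomial (Option (Fin n)) ℂ
  let K := FractionRing R
  let ξ : K := ∏ i : Fin n, algebraMap R K (X (some i))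
  have hξ : ξ ≠ 0 := Finset.prod_ne_zero_iff.2 fun i _ => by
    rw [Ne, IsFractionRing.to_map_eq_zero_iff]; exact X_ne_zero _
  let f : A →ₐ[ℂ] K := subst (fun i => algebraMap R K (X (some i)))
    ((algebraMap R K (X none) - ξ * Polynomial.aeval 0 q) / ξ ^ 2) 0
  have hf : f.comp (baseRing n q) = IsScalarTower.toAlgHom ℂ R K := by
    refine MvPolynomial.algHom_ext fun o => ?_
    cases o with
    | none =>
      have hx : f (xprod n) = ξ := by simp [f, ξ, map_xprod]
      simp only [baseRing, AlgHom.comp_apply, aeval_X, Option.elim]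
      rw [map_polyP, hx]
      simp only [f, subst_vary, subst_varz]
      rw [mul_div_cancel₀ _ (pow_ne_zero 2 hξ)]
      simp only [zero_pow two_ne_zero, sub_add_cancel, add_zero]
      rfl
    | some i =>
      simp only [baseRing, f, AlgHom.comp_apply, aeval_X, Option.elim, subst_varx]
      rfl
  have : Function.Injective (f.comp (baseRing n q)) := by
    rw [hf]; exact IsFractionRing.injective R K
  exact Function.Injective.of_comp (f := f) this

theorem stdDer_baseRing (q : Polynomial ℂ) (p : MvPolynomial (Option (Fin n)) ℂ) :
    stdDer n q (baseRing n q p) = 0 := by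
  induction p using MvPolynomial.induction_on with
  | C a => rw [← algebraMap_eq, AlgHom.commutes, Derivation.map_algebraMap]
  | add f g hf hg => rw [map_add, map_add, hf, hg, add_zero]
  | mul_X f o hf =>
    have : stdDer n q (baseRing n q (X o)) = 0 := by cases o <;> simp [baseRing]
    rw [map_mul, Derivation.leibniz, hf, this, smul_zero, smul_zero, add_zero]

/-- A derivation annihilating the `x_i` and `P` is proportional to the standard one. -/
theorem xprod_sq_mul_apply {q : Polynomial ℂ} (E : Derivation ℂ A A)
    (hx : ∀ i : Fin n, E (varx i) = 0) (hP : E (polyP n q) = 0) (f : A) :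
    xprod n ^ 2 * E f = E (varz n) * stdDer n q f := by
  have : (xprod n ^ 2 : A) • E = E (varz n) • stdDer n q := by
    rw [E.map_polyP q hx] at hP
    refine derivation_ext_var (fun i => by simp [hx]) ?_ ?_
    · simp only [Derivation.smul_apply, smul_eq_mul, stdDer_vary]
      linear_combination hP
    · simp only [Derivation.smul_apply, smul_eq_mul, stdDer_varz]
      ring
  exact DFunLike.congr_fun this f

theorem stdDer_eq_zero_of_xprod_mul {q : Polynomial ℂ} {f : A} (k : ℕ)
    (h : stdDer n q (xprod n ^ k * f) = 0) : stdDer n q f = 0 := by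
  rw [Derivation.leibniz, Derivation.leibniz_pow, stdDer_xprod, smul_zero, smul_zero, smul_zero,
    add_zero, smul_eq_mul] at h
  exact (mul_eq_zero.1 h).resolve_left (pow_ne_zero _ xprod_ne_zero)

/-- An element killed by the square of the standard derivation is of degree one in `z` over the
kernel. -/
theorem exists_eq_mul_varz_add {q : Polynomial ℂ} {h : A} (hh : stdDer n q (stdDer n q h) = 0) :
    ∃ k w, stdDer n q k = 0 ∧ stdDer n q w = 0 ∧ h = k * varz n + w := by
  set D := stdDer n q with hD
  have hw : D (xprod n ^ 2 * h - D h * varz n) = 0 := by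
    rw [map_sub, D.leibniz, D.leibniz, D.leibniz_pow, hh, hD, stdDer_xprod, stdDer_varz]
    simp [mul_comm]
  -- The kernel element x²h − D(h) z and D(h) are both even in z, so 2 D(h) z = x²(h − flip h).
  -- Hence x² divides 2 D(h), with quotient g in the kernel, and k = g/2.
  have h1 := flipz_of_stdDer_eq_zero q hw
  have h2 := flipz_of_stdDer_eq_zero q hh
  rw [map_sub, map_mul, map_mul, map_pow, flipz_xprod, flipz_varz, h2] at h1
  obtain ⟨g, hg⟩ := varz_dvd_of_flipz_eq_neg (f := h - flipz n h) (by simp)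
  have h3 : xprod n ^ 2 * g = 2 * D h := by
    refine mul_left_cancel₀ (varz_ne_zero (n := n)) ?_
    linear_combination -xprod n ^ 2 * hg - h1
  have h2' : D 2 = 0 := D.map_natCast 2
  have hg0 : D g = 0 := by
    refine stdDer_eq_zero_of_xprod_mul 2 ?_
    rw [h3, ← hD, D.leibniz, hh, h2']
    simp
  have hc : (C (1 / 2) : A) * 2 = 1 := by
    rw [← map_ofNat C 2, ← C_mul]; norm_num
  have hk : D (C (1 / 2) * g) = 0 := by
    rw [← smul_eq_C_mul, Derivation.map_smul, hg0, smul_zero]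
  refine ⟨C (1 / 2) * g, h - C (1 / 2) * g * varz n, hk, ?_, by ring⟩
  rw [map_sub, D.leibniz, hk, hD, stdDer_varz, ← hD]
  simp only [smul_eq_mul, mul_zero, add_zero]
  linear_combination (-C (1 / 2)) * h3 - D h * hc

variable {q₁ q₂ : Polynomial ℂ} {a b : ℂ} 
  {φ : MvPolynomial (Fin (n + 2)) ℂ ≃ₐ[ℂ] MvPolynomial (Fin (n + 2)) ℂ}

theorem symm_polyP (ha : a ≠ 0) (hφ : φ (polyP n q₁) = C a * polyP n q₂ + C b) :
    φ.symm (polyP n q₂) = C a⁻¹ * polyP n q₁ + C (-(a⁻¹ * b)) := by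
  have hC : ∀ c : ℂ, φ (C c) = C c := fun c => φ.commutes c
  rw [AlgEquiv.symm_apply_eq, map_add, map_mul, hC, hC, hφ, mul_add, ← mul_assoc, ← C_mul, ← C_mul,
    inv_mul_cancel₀ ha]
  simp

theorem conj_polyP (hφ : φ (polyP n q₁) = C a * polyP n q₂ + C b) :
    (stdDer n q₂).conj φ (polyP n q₁) = 0 := by
  rw [Derivation.conj_apply, hφ, map_add, ← smul_eq_C_mul, Derivation.map_smul, stdDer_polyP,
    ← algebraMap_eq, Derivation.map_algebraMap]
  simp

/-- The kernel of the conjugate contains the preimage under φ of the polynomial ring in the x_i and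
P_{q₂}. -/
theorem conj_varx (hφ : φ (polyP n q₁) = C a * polyP n q₂ + C b) (i : Fin n) :
    (stdDer n q₂).conj φ (varx i) = 0 := by
  refine apply_varx_eq_zero (conj_polyP hφ) ((stdDer_locallyNilpotent q₂).conj φ)
    (φ.symm.toAlgHom.comp (baseRing n q₂))
    (φ.symm.injective.comp (baseRing_injective q₂)) (fun p => ?_) i
  rw [Derivation.conj_apply]
  change φ.symm (stdDer n q₂ (φ (φ.symm (baseRing n q₂ p)))) = 0
  rw [AlgEquiv.apply_symm_apply, stdDer_baseRing, map_zero]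

theorem stdDer_map_xprod (hφ : φ (polyP n q₁) = C a * polyP n q₂ + C b) :
    stdDer n q₂ (φ (xprod n)) = 0 := by
  have := ((stdDer n q₂).conj φ).map_xprod_eq_zero (conj_varx hφ)
  rw [Derivation.conj_apply] at this
  simpa using this

theorem stdDer_map_eq_zero (hφ : φ (polyP n q₁) = C a * polyP n q₂ + C b) {f : A}
    (hf : stdDer n q₁ f = 0) : stdDer n q₂ (φ f) = 0 := by
  have := xprod_sq_mul_apply _ (conj_varx hφ) (conj_polyP hφ) f
  rw [hf, mul_zero] at this
  have := (mul_eq_zero.1 this).resolve_left (pow_ne_zero _ xprod_ne_zero)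
  rw [Derivation.conj_apply] at this
  simpa using this

/-- Applying the proportionality of the two derivations to φ⁻¹(z) shows that D(φ(z)) divides
φ(x)²x², a nonzero kernel element; factorial closedness concludes. -/
theorem stdDer_stdDer_map_varz (ha : a ≠ 0) (hφ : φ (polyP n q₁) = C a * polyP n q₂ + C b) :
    stdDer n q₂ (stdDer n q₂ (φ (varz n))) = 0 := by
  have hφ' := symm_polyP ha hφ
  have h1 := fun f => xprod_sq_mul_apply _ (conj_varx hφ) (conj_polyP hφ) f
  have h2 := congrArg φ (h1 (φ.symm (varz n)))
  simp only [Derivation.conj_apply, map_mul, map_pow, AlgEquiv.apply_symm_apply, stdDer_varz] at h2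
  have hne : φ (xprod n) ^ 2 * xprod n ^ 2 ≠ 0 :=
    mul_ne_zero (pow_ne_zero _ ((map_ne_zero_iff φ φ.injective).2 xprod_ne_zero))
      (pow_ne_zero _ xprod_ne_zero)
  refine (stdDer_locallyNilpotent q₂).eq_zero_of_mul (g := φ (stdDer n q₁ (φ.symm (varz n))))
    ?_ ?_ ?_
  · intro h0; rw [h0, zero_mul] at h2; exact hne h2
  · intro h0; rw [h0, mul_zero] at h2; exact hne h2
  · rw [← h2]
    simp [Derivation.leibniz, Derivation.leibniz_pow, stdDer_map_xprod hφ]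

/-- The image of `z` is `β z + w` with `β` a nonzero constant and `w` in the kernel. -/
theorem exists_map_varz (ha : a ≠ 0) (hφ : φ (polyP n q₁) = C a * polyP n q₂ + C b) :
    ∃ β : ℂ, β ≠ 0 ∧ ∃ w, stdDer n q₂ w = 0 ∧ φ (varz n) = C β * varz n + w := by
  obtain ⟨k, w, hk, hw, h⟩ := exists_eq_mul_varz_add (stdDer_stdDer_map_varz ha hφ)
  have hφ' := symm_polyP ha hφ
  obtain ⟨k', w', hk', hw', h'⟩ :=
    exists_eq_mul_varz_add (stdDer_stdDer_map_varz (inv_ne_zero ha) hφ')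
  -- Applying D to z = φ(k')(kz + w) + φ(w') gives x² = φ(k') k x², so k is a unit.
  have h1 := congrArg (stdDer n q₂) (congrArg φ h')
  rw [AlgEquiv.apply_symm_apply, map_add, map_mul, map_add, h, Derivation.leibniz,
    stdDer_map_eq_zero hφ hk', stdDer_map_eq_zero hφ hw', map_add, Derivation.leibniz, hk, hw,
    stdDer_varz] at h1
  simp only [add_zero, smul_eq_mul] at h1
  have h2 : k * φ k' = 1 := by
    refine mul_right_cancel₀ (pow_ne_zero 2 (xprod_ne_zero (n := n))) ?_
    linear_combination -h1
  obtain ⟨β, hβ, rfl⟩ := MvPolynomial.isUnit_iff_eq_C_of_isReduced.1 (IsUnit.of_mul_eq_one _ h2)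
  exact ⟨β, hβ.ne_zero, w, hw, h⟩

/-- φ(x) divides φ(P_{q₁}) − φ(z)² = aP_{q₂} + b − (βz + w)². Since φ(x) is in the kernel, D²
preserves the divisibility and turns the right side into −2β²x⁴. -/
theorem map_xprod_dvd (ha : a ≠ 0) (hφ : φ (polyP n q₁) = C a * polyP n q₂ + C b) :
    φ (xprod n) ∣ xprod n ^ 4 := by
  obtain ⟨β, hβ, w, hw, h⟩ := exists_map_varz ha hφ
  have h1 : φ (xprod n) * (φ (xprod n) * φ (vary n) + Polynomial.aeval (φ (varz n) ^ 2) q₁) =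
      C a * polyP n q₂ + C b - (C β * varz n + w) ^ 2 := by
    rw [← hφ, ← h, ← AlgEquiv.coe_toAlgHom φ, map_polyP]
    ring
  set H := φ (xprod n) * φ (vary n) + Polynomial.aeval (φ (varz n) ^ 2) q₁
  have hC : ∀ c : ℂ, stdDer n q₂ (C c) = 0 := fun c => Derivation.map_algebraMap _ c
  have h2 : φ (xprod n) * stdDer n q₂ (stdDer n q₂ H) = -(2 * C β ^ 2 * xprod n ^ 4) := by
    have h3 := congrArg (fun f => stdDer n q₂ (stdDer n q₂ f)) h1
    simp only [map_sub, map_add, Derivation.leibniz, Derivation.leibniz_pow, hC, hw,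
      stdDer_map_xprod hφ, stdDer_polyP, stdDer_varz, smul_eq_mul, nsmul_eq_mul,
      mul_zero, add_zero, zero_sub] at h3
    have h4 : stdDer n q₂ 2 = 0 := Derivation.map_natCast _ 2
    simp [Derivation.leibniz, Derivation.leibniz_pow, hC, hw, h4] at h3
    rw [h3]
    ring
  refine ⟨stdDer n q₂ (stdDer n q₂ H) * C (-(2 * β ^ 2)⁻¹), ?_⟩
  rw [← mul_assoc, h2]
  have : (C (2 * β ^ 2) : A) * C (-(2 * β ^ 2)⁻¹) = -1 := by
    rw [← C_mul, mul_neg, mul_inv_cancel₀ (by simp [hβ])]; simp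
  have h5 : (C (2 * β ^ 2) : A) = 2 * C β ^ 2 := by rw [C_mul, C_pow]; rfl
  rw [h5] at this
  linear_combination xprod n ^ 4 * this

theorem exists_map_varx (ha : a ≠ 0) (hφ : φ (polyP n q₁) = C a * polyP n q₂ + C b) (i : Fin n) :
    ∃ j : Fin n, ∃ α : ℂ, α ≠ 0 ∧ φ (varx i) = C α * varx j := by
  have hp : Prime (φ (varx i)) := (MulEquiv.prime_iff φ.toMulEquiv).2 (varx_prime i)
  have h1 : φ (varx i) ∣ xprod n ^ 4 :=
    (map_dvd φ (varx_dvd_xprod i)).trans (map_xprod_dvd ha hφ)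
  obtain ⟨j, -, hj⟩ := (Prime.dvd_finsetProd_iff hp _).1 (hp.dvd_of_dvd_pow h1)
  obtain ⟨u, hu⟩ := (hp.irreducible.associated_of_dvd (varx_prime j).irreducible hj).symm
  obtain ⟨α, hα, hα'⟩ := MvPolynomial.isUnit_iff_eq_C_of_isReduced.1 u.isUnit
  exact ⟨j, α, hα.ne_zero, by rw [← hu, hα', mul_comm]⟩

theorem exists_map_xprod (ha : a ≠ 0) (hφ : φ (polyP n q₁) = C a * polyP n q₂ + C b) :
    ∃ α : ℂ, α ≠ 0 ∧ φ (xprod n) = C α * xprod n := by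
  choose σ α hα h using exists_map_varx ha hφ
  have hσ : Function.Injective σ := by
    intro i j hij
    have h1 : φ (varx i) ∣ φ (varx j) := by
      rw [h, h, hij]
      refine mul_dvd_mul_right ?_ _
      refine IsUnit.dvd ?_
      exact (IsUnit.mk0 _ (hα i)).map C
    exact eq_of_varx_dvd ((map_dvd_iff φ).1 h1)
  refine ⟨∏ i, α i, Finset.prod_ne_zero_iff.2 fun i _ => hα i, ?_⟩
  rw [xprod, map_prod, map_prod]
  simp only [h]
  rw [Finset.prod_mul_distrib]
  congr 1
  exact Fintype.prod_bijective σ (Finite.injective_iff_bijective.1 hσ) _ _ fun _ => rfl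

/-- The substitution of `0` for `x_i`. -/
def zeroX (i : Fin n) : MvPolynomial (Fin (n + 2)) ℂ →ₐ[ℂ] MvPolynomial (Fin (n + 2)) ℂ :=
  subst (fun j => if j = i then 0 else varx j) (vary n) (varz n)

@[simp] theorem zeroX_vary (i : Fin n) : zeroX i (vary n) = vary n := subst_vary _ _ _
@[simp] theorem zeroX_varz (i : Fin n) : zeroX i (varz n) = varz n := subst_varz _ _ _
@[simp] theorem zeroX_varx (i j : Fin n) :
    zeroX i (varx j) = if j = i then 0 else varx j := subst_varx _ _ _ _

@[simp] theorem zeroX_xprod (i : Fin n) : zeroX i (xprod n) = 0 := by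
  rw [map_xprod]
  exact Finset.prod_eq_zero (Finset.mem_univ i) (by simp)

theorem varx_dvd_of_zeroX {i : Fin n} {f : A} (h : zeroX i f = 0) : varx i ∣ f := by
  have : ((Ideal.Quotient.mkₐ ℂ (Ideal.span {varx i})).comp (zeroX i)) =
      Ideal.Quotient.mkₐ ℂ (Ideal.span {varx i}) := by
    refine algHom_ext_var (fun j => ?_) (by simp) (by simp)
    rw [AlgHom.comp_apply, zeroX_varx]
    split_ifs with hj
    · subst hj
      rw [map_zero, Ideal.Quotient.mkₐ_eq_mk]
      exact (Ideal.Quotient.eq_zero_iff_mem.2 (Ideal.mem_span_singleton_self _)).symm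
    · rfl
  have h2 := DFunLike.congr_fun this f
  rw [AlgHom.comp_apply, h, map_zero, Ideal.Quotient.mkₐ_eq_mk] at h2
  exact Ideal.mem_span_singleton.1 (Ideal.Quotient.eq_zero_iff_mem.1 h2.symm)

theorem flipz_zeroX (i : Fin n) (f : A) : flipz n (zeroX i f) = zeroX i (flipz n f) := by
  have : (flipz n).comp (zeroX i) = (zeroX i).comp (flipz n) := by
    refine algHom_ext_var (fun j => ?_) (by simp) (by simp)
    simp only [AlgHom.comp_apply, zeroX_varx, flipz_varx]
    split_ifs <;> simp
  exact DFunLike.congr_fun this f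

/-- Every complex number is a square, so evaluating z recovers all values of the polynomial. -/
theorem aeval_varz_sq_injective :
    Function.Injective (Polynomial.aeval (varz n ^ 2 : A) : Polynomial ℂ → A) := by
  intro p r h
  refine Polynomial.funext fun t => ?_
  obtain ⟨s, hs⟩ := IsAlgClosed.exists_pow_nat_eq t (two_pos)
  have := congrArg (subst (fun _ => 0) 0 s : A →ₐ[ℂ] ℂ) h
  rw [← Polynomial.aeval_algHom_apply, ← Polynomial.aeval_algHom_apply] at this
  simpa [hs] using this

/-- If an automorphism maps `P_{q₁}` to `a P_{q₂} + b`, then `b = 0` and `q₂` is determined by `q₁`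
up to a factor. -/
theorem rigidity (hn : 1 ≤ n) (ha : a ≠ 0) (hφ : φ (polyP n q₁) = C a * polyP n q₂ + C b) :
    b = 0 ∧ ∃ α : ℂ, α ≠ 0 ∧
      Polynomial.C α * q₁.comp (Polynomial.C a * Polynomial.X) = Polynomial.C a * q₂ := by
  obtain ⟨β, hβ, w, hw, hz⟩ := exists_map_varz ha hφ
  obtain ⟨α, hα, hx⟩ := exists_map_xprod ha hφ
  have hP : (C α * xprod n) ^ 2 * φ (vary n) + (C β * varz n + w) ^ 2 +
      C α * xprod n * Polynomial.aeval ((C β * varz n + w) ^ 2) q₁ =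
      C a * (xprod n ^ 2 * vary n + varz n ^ 2 + xprod n * Polynomial.aeval (varz n ^ 2) q₂) +
        C b := by
    rw [← polyP_eq, ← hφ, ← hz, ← hx, ← AlgEquiv.coe_toAlgHom φ, map_polyP]
  have hflipC : ∀ c : ℂ, flipz n (C c) = C c := fun c => (flipz n).commutes c
  have hzeroC : ∀ (i : Fin n) (c : ℂ), zeroX i (C c) = C c := fun i c => (zeroX i).commutes c
  have h4 : (4 * C β * varz n : A) ≠ 0 := by
    refine mul_ne_zero (mul_ne_zero ?_ ?_) varz_ne_zero
    · rw [← map_ofNat C 4, Ne, C_eq_zero]; norm_num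
    · rwa [Ne, C_eq_zero]
  -- At x_i = 0 the identity reads (βz + w)² = az² + b with w even in z; subtracting its image under
  -- z ↦ −z leaves 4βzw = 0.
  have hw0 : ∀ i : Fin n, zeroX i w = 0 ∧ C a * varz n ^ 2 + C b = (C β * varz n) ^ 2 := by
    intro i
    have h1 := congrArg (zeroX i) hP
    simp only [map_add, map_mul, map_pow, zeroX_xprod, zeroX_varz, hzeroC] at h1
    have h2 := congrArg (flipz n) h1
    simp only [map_add, map_mul, map_pow, map_zero, flipz_varz, hflipC, flipz_zeroX,
      flipz_of_stdDer_eq_zero q₂ hw] at h2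
    have h3 : zeroX i w = 0 := by
      refine (mul_eq_zero.1 ?_).resolve_left h4
      linear_combination h1 - h2
    rw [h3] at h1
    exact ⟨h3, by linear_combination -h1⟩
  let i₀ : Fin n := ⟨0, hn⟩
  have hsq := (hw0 i₀).2
  have hb : b = 0 := by
    have := congrArg (subst (fun _ => 0) 0 0 : A →ₐ[ℂ] ℂ) hsq
    simpa [MvPolynomial.algHom_C] using this
  subst hb
  have hβa : β ^ 2 = a := by
    have := congrArg (subst (fun _ => 0) 0 1 : A →ₐ[ℂ] ℂ) hsq
    simpa [MvPolynomial.algHom_C] using this.symm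
  refine ⟨rfl, α, hα, ?_⟩
  -- Every x_i divides w, hence so does x. After dividing the identity by x, the same parity
  -- argument at x_{i₀} = 0 removes s and leaves α q₁(az²) = a q₂(z²).
  obtain ⟨s, rfl⟩ : xprod n ∣ w := by
    refine Finset.prod_dvd_of_isRelPrime (fun i _ j _ hij => ?_)
      fun i _ => varx_dvd_of_zeroX (hw0 i).1
    exact ((varx_prime i).irreducible.isRelPrime_iff_not_dvd).2 fun h => hij (eq_of_varx_dvd h)
  have hs : stdDer n q₂ s = 0 := stdDer_eq_zero_of_xprod_mul 1 (by rwa [pow_one])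
  have hCa : (C β ^ 2 : A) = C a := by rw [← C_pow, hβa]
  have h5 : C α ^ 2 * xprod n * φ (vary n) + 2 * C β * varz n * s + xprod n * s ^ 2 +
      C α * Polynomial.aeval ((C β * varz n + xprod n * s) ^ 2) q₁ =
      C a * xprod n * vary n + C a * Polynomial.aeval (varz n ^ 2) q₂ := by
    refine mul_left_cancel₀ (xprod_ne_zero (n := n)) ?_
    rw [C_0] at hP
    linear_combination hP - varz n ^ 2 * hCa
  have h6 := congrArg (zeroX i₀) h5
  simp only [map_add, map_mul, map_pow, zeroX_xprod, zeroX_varz, zeroX_vary, hzeroC, map_ofNat,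
    ← Polynomial.aeval_algHom_apply] at h6
  have h7 := congrArg (flipz n) h6
  simp only [map_add, map_mul, map_pow, map_zero, flipz_varz, hflipC, flipz_zeroX, map_ofNat,
    flipz_of_stdDer_eq_zero q₂ hs, ← Polynomial.aeval_algHom_apply] at h7
  have hev : ((C β * -varz n + 0 * zeroX i₀ s) ^ 2 : A) = (C β * varz n + 0 * zeroX i₀ s) ^ 2 := by
    ring
  have hev2 : ((-varz n) ^ 2 : A) = varz n ^ 2 := by ring
  rw [hev, hev2] at h7
  have h8 : zeroX i₀ s = 0 := by
    refine (mul_eq_zero.1 ?_).resolve_left h4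
    linear_combination h6 - h7
  rw [h8] at h6
  apply aeval_varz_sq_injective (n := n)
  have h9 : ((C β * varz n + 0 * 0) ^ 2 : A) = Polynomial.aeval (varz n ^ 2)
      (Polynomial.C a * Polynomial.X) := by
    rw [map_mul, Polynomial.aeval_C, Polynomial.aeval_X, algebraMap_eq, ← hCa]; ring
  rw [h9] at h6
  rw [map_mul, map_mul, Polynomial.aeval_comp, Polynomial.aeval_C, Polynomial.aeval_C,
    algebraMap_eq]
  linear_combination h6

end Rigidity

end

/-! ### From automorphisms and zero sets to algebra, and back. -/

noncomputable section

/-- The inverse of a polynomial automorphism. -/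
def PolyAut.symm {m : ℕ} (Φ : PolyAut m) : PolyAut m where
  toEquiv := Φ.toEquiv.symm
  coord := Φ.coordInv
  coordInv := Φ.coord
  apply_eq := Φ.symm_apply_eq
  symm_apply_eq := Φ.apply_eq

/-- The pull-back by a polynomial automorphism as an automorphism of the polynomial ring. -/
def PolyAut.algEquiv {m : ℕ} (Φ : PolyAut m) :
    MvPolynomial (Fin m) ℂ ≃ₐ[ℂ] MvPolynomial (Fin m) ℂ :=
  AlgEquiv.ofAlgHom Φ.pullback Φ.symm.pullback
    (AlgHom.ext fun P => MvPolynomial.funext fun x => by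
      rw [AlgHom.comp_apply, eval_pullback, eval_pullback, AlgHom.id_apply]
      exact congrArg (fun t => eval t P) (Φ.toEquiv.symm_apply_apply x))
    (AlgHom.ext fun P => MvPolynomial.funext fun x => by
      rw [AlgHom.comp_apply, eval_pullback, eval_pullback, AlgHom.id_apply]
      exact congrArg (fun t => eval t P) (Φ.toEquiv.apply_symm_apply x))

/-- The diagonal automorphism with coefficients `u`. -/
def PolyAut.diagonal {m : ℕ} (u : Fin m → ℂˣ) : PolyAut m where
  toEquiv :=
    { toFun := fun x i => u i * x i
      invFun := fun x i => ↑(u i)⁻¹ * x i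
      left_inv := fun x => funext fun i => by simp
      right_inv := fun x => funext fun i => by simp }
  coord i := C (u i : ℂ) * X i
  coordInv i := C (↑(u i)⁻¹ : ℂ) * X i
  apply_eq x i := by simp
  symm_apply_eq x i := by simp

/-- By the Nullstellensatz the prime ideal (f) contains every polynomial vanishing on its zero set,
in particular g. -/
theorem associated_of_hypersurface_eq {m : ℕ} {f g : MvPolynomial (Fin m) ℂ}
    (hf : Irreducible f) (hg : Irreducible g) (h : hypersurface f = hypersurface g) :
    Associated f g := by
  refine hf.associated_of_dvd hg ?_
  have hp : (Ideal.span {f}).IsPrime := (Ideal.span_singleton_prime hf.ne_zero).2 hf.prime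
  rw [← Ideal.mem_span_singleton, ← MvPolynomial.IsPrime.vanishingIdeal_zeroLocus (K := ℂ)
    (Ideal.span {f}), mem_vanishingIdeal_iff]
  intro x hx
  have hx' : x ∈ hypersurface g := h ▸ hx
  rw [mem_hypersurface] at hx'
  rwa [aeval_eq_eval]

variable {n : ℕ}

/-- The polynomial is linear in y with leading coefficient x². No x_i divides the constant term,
which at x_1 = ⋯ = x_n = 0 is the nonzero polynomial z² − c. -/
theorem polyP_sub_C_irreducible (q : Polynomial ℂ) (c : ℂ) :
    Irreducible (polyP n q - C c) := by
  have hmem : ∀ f : MvPolynomial (Fin (n + 2)) ℂ,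
      f ∈ supported ℂ ({Fin.natAdd n 0}ᶜ : Set (Fin (n + 2))) → Fin.natAdd n 0 ∉ f.vars := by
    intro f hf h
    exact (mem_supported.1 hf (Finset.mem_coe.2 h)) rfl
  have hx : ∀ i : Fin n, varx i ∈ supported ℂ ({Fin.natAdd n 0}ᶜ : Set (Fin (n + 2))) := by
    intro i
    refine X_mem_supported.2 fun h => ?_
    have := congrArg Fin.val h
    simp at this
    omega
  have hxi : xprod n ∈ supported ℂ ({Fin.natAdd n 0}ᶜ : Set (Fin (n + 2))) :=
    prod_mem fun i _ => hx i
  have hz : varz n ∈ supported ℂ ({Fin.natAdd n 0}ᶜ : Set (Fin (n + 2))) := by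
    refine X_mem_supported.2 fun h => ?_
    have := congrArg Fin.val h
    simp at this
  have h := irreducible_mul_X_add (xprod n ^ 2)
    (varz n ^ 2 + xprod n * Polynomial.aeval (varz n ^ 2) q - C c) (Fin.natAdd n 0)
    (pow_ne_zero _ xprod_ne_zero) (hmem _ (pow_mem hxi 2))
    (hmem _ (sub_mem (add_mem (pow_mem hz 2) (mul_mem hxi
      (Algebra.adjoin_le (Set.singleton_subset_iff.2 (pow_mem hz 2))
        (Polynomial.aeval_mem_adjoin_singleton ℂ _)))) (Subalgebra.algebraMap_mem _ c))) ?_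
  · have h2 : polyP n q - C c = xprod n ^ 2 * X (Fin.natAdd n 0) +
        (varz n ^ 2 + xprod n * Polynomial.aeval (varz n ^ 2) q - C c) := by
      rw [polyP_eq, vary]; ring
    rwa [h2]
  · refine IsRelPrime.pow_left (IsRelPrime.prod_left fun i _ => ?_)
    refine (varx_prime i).irreducible.isRelPrime_iff_not_dvd.2 ?_
    rintro ⟨g, hg⟩
    have key : ∀ s : ℂ, s ^ 2 = c := by
      intro s
      have h0 : subst (fun _ => (0 : ℂ)) 0 s (xprod n) = 0 := by
        rw [map_xprod]
        exact Finset.prod_eq_zero (Finset.mem_univ i) (by simp)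
      have := congrArg (subst (fun _ => (0 : ℂ)) 0 s) hg
      simp only [map_sub, map_add, map_mul, map_pow, h0, subst_varz, subst_varx, zero_mul,
        add_zero, algHom_C, Algebra.algebraMap_self_apply] at this
      exact sub_eq_zero.1 this
    have h0 := key 0
    have h1 := key 1
    rw [← h0] at h1
    norm_num at h1

/-- Scale a single x_i by α, y by a/α² and z by a square root of a: then x²y and z² are multiplied
by a, and the hypothesis handles the last term. -/
theorem exists_polyAut (hn : 1 ≤ n) {q₁ q₂ : Polynomial ℂ} {a α : ℂ} (ha : a ≠ 0) (hα : α ≠ 0)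
    (h : Polynomial.C α * q₁.comp (Polynomial.C a * Polynomial.X) = Polynomial.C a * q₂) :
    ∃ Φ : PolyAut (n + 2), Φ.pullback (polyP n q₁) = C a * polyP n q₂ := by
  obtain ⟨β, hβ⟩ := IsAlgClosed.exists_pow_nat_eq a two_pos
  have hβ0 : β ≠ 0 := by
    rintro rfl
    exact ha (by rw [← hβ]; simp)
  have hγ : a / α ^ 2 ≠ 0 := div_ne_zero ha (pow_ne_zero 2 hα)
  let i₀ : Fin n := ⟨0, hn⟩
  let u : Fin (n + 2) → ℂˣ := Fin.append (fun i => if i = i₀ then Units.mk0 α hα else 1)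
    ![Units.mk0 _ hγ, Units.mk0 β hβ0]
  let Φ := PolyAut.diagonal u
  have hX : ∀ i, Φ.pullback (X i) = C (u i : ℂ) * X i := fun i => aeval_X _ _
  have hx : ∀ i, Φ.pullback (varx i) = C (if i = i₀ then α else 1) * varx i := by
    intro i
    rw [varx, hX]
    simp only [u, Fin.append_left]
    split_ifs <;> simp
  have hxi : Φ.pullback (xprod n) = C α * xprod n := by
    rw [map_xprod]
    simp only [hx]
    rw [Finset.prod_mul_distrib, ← map_prod, Finset.prod_ite_eq' Finset.univ i₀,
      if_pos (Finset.mem_univ _), xprod]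
  have hy : Φ.pullback (vary n) = C (a / α ^ 2) * vary n := by
    rw [vary, hX]
    simp only [u, Fin.append_right]
    rfl
  have hz : Φ.pullback (varz n) = C β * varz n := by
    rw [varz, hX]
    simp only [u, Fin.append_right]
    rfl
  have h1 := congrArg (Polynomial.aeval (varz n ^ 2)) h
  rw [map_mul, map_mul, Polynomial.aeval_comp, Polynomial.aeval_C, Polynomial.aeval_C, map_mul,
    Polynomial.aeval_C, Polynomial.aeval_X, algebraMap_eq] at h1
  have hCβ : (C β * varz n) ^ 2 = C a * varz n ^ 2 := by rw [mul_pow, ← C_pow, hβ]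
  have hCα : (C α : MvPolynomial (Fin (n + 2)) ℂ) ^ 2 * C (a / α ^ 2) = C a := by
    rw [← C_pow, ← C_mul, mul_div_cancel₀ _ (pow_ne_zero 2 hα)]
  refine ⟨Φ, ?_⟩
  rw [map_polyP, hxi, hy, hz, hCβ, polyP_eq]
  linear_combination (xprod n ^ 2 * vary n) * hCα + xprod n * h1

end

theorem mainTheorem3 (n : ℕ) (hn : 1 ≤ n) (q₁ q₂ : Polynomial ℂ) (c₁ c₂ : ℂ) :
    (EquivalentPolynomials (polyP n q₁ - MvPolynomial.C c₁) (polyP n q₂ - MvPolynomial.C c₂) ↔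
      c₁ = c₂ ∧ ∃ l : ℂ, l ≠ 0 ∧ q₂ = Polynomial.C l * q₁) ∧
    (EquivalentSubsets (hypersurface (polyP n q₁ - MvPolynomial.C c₁))
        (hypersurface (polyP n q₂ - MvPolynomial.C c₂)) ↔
      ∃ l m : ℂ, l ≠ 0 ∧ m ≠ 0 ∧ c₂ = m⁻¹ * c₁ ∧
        q₂ = Polynomial.C l * q₁.comp (Polynomial.C m * Polynomial.X)) := by
  refine ⟨⟨?_, ?_⟩, ⟨?_, ?_⟩⟩
  · rintro ⟨Φ, hΦ⟩
    have hφ : Φ.algEquiv (polyP n q₁) = C 1 * polyP n q₂ + C (c₁ - c₂) := by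
      change Φ.pullback (polyP n q₁) = _
      rw [map_sub, algHom_C, algebraMap_eq] at hΦ
      rw [C_1, C_sub]
      linear_combination hΦ
    obtain ⟨hb, α, hα, h⟩ := rigidity hn one_ne_zero hφ
    exact ⟨sub_eq_zero.1 hb, α, hα, by simpa using h.symm⟩
  · rintro ⟨rfl, l, hl, rfl⟩
    obtain ⟨Φ, hΦ⟩ := exists_polyAut hn (q₁ := q₁) (q₂ := Polynomial.C l * q₁) one_ne_zero hl
      (by simp)
    refine ⟨Φ, ?_⟩
    rw [map_sub, hΦ, algHom_C, algebraMap_eq, C_1, one_mul]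
  · rintro ⟨Φ, hΦ⟩
    have hV : hypersurface (Φ.algEquiv (polyP n q₂ - C c₂)) = hypersurface (polyP n q₁ - C c₁) := by
      ext x
      rw [mem_hypersurface]
      change eval x (Φ.pullback _) = 0 ↔ _
      rw [Φ.eval_pullback, ← mem_hypersurface, ← hΦ, Φ.toEquiv.injective.mem_set_image]
    have hirr : Irreducible (Φ.algEquiv (polyP n q₂ - C c₂)) :=
      (MulEquiv.irreducible_iff Φ.algEquiv.toMulEquiv).2 (polyP_sub_C_irreducible q₂ c₂)
    obtain ⟨u, hu⟩ :=
      (associated_of_hypersurface_eq hirr (polyP_sub_C_irreducible q₁ c₁) hV)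
    obtain ⟨a, ha, hua⟩ := MvPolynomial.isUnit_iff_eq_C_of_isReduced.1 u.isUnit
    -- Units of the polynomial ring are constants, so the inverse pull-back sends P_{q₁} − c₁ to
    -- a(P_{q₂} − c₂); a will be the μ of the statement.
    have hφ : Φ.algEquiv.symm (polyP n q₁) = C a * polyP n q₂ + C (c₁ - a * c₂) := by
      have hC : ∀ c : ℂ, Φ.algEquiv.symm (C c) = C c := fun c => Φ.algEquiv.symm.commutes c
      have := congrArg Φ.algEquiv.symm hu
      rw [map_mul, AlgEquiv.symm_apply_apply, hua, hC, map_sub, hC] at this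
      rw [C_sub, C_mul]
      linear_combination -this
    obtain ⟨hb, α, hα, h⟩ := rigidity hn ha.ne_zero hφ
    refine ⟨a⁻¹ * α, a, mul_ne_zero (inv_ne_zero ha.ne_zero) hα, ha.ne_zero, ?_, ?_⟩
    · rw [sub_eq_zero.1 hb, inv_mul_cancel_left₀ ha.ne_zero]
    · rw [Polynomial.C_mul, mul_assoc, h, ← mul_assoc, ← Polynomial.C_mul,
        inv_mul_cancel₀ ha.ne_zero, Polynomial.C_1, one_mul]
  · rintro ⟨l, m, hl, hm, rfl, rfl⟩
    obtain ⟨Φ, hΦ⟩ := exists_polyAut hn (q₁ := q₁)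
      (q₂ := Polynomial.C l * q₁.comp (Polynomial.C m * Polynomial.X)) hm (mul_ne_zero hm hl)
      (by rw [Polynomial.C_mul, mul_assoc])
    -- Φ pulls the first polynomial back to a multiple of the second, so as a map of points it goes
    -- from the second hypersurface to the first.
    refine ⟨Φ.symm, ?_⟩
    have hpull : Φ.pullback (polyP n q₁ - C c₁) =
        C m * (polyP n (Polynomial.C l * q₁.comp (Polynomial.C m * Polynomial.X)) -
          C (m⁻¹ * c₁)) := by
      rw [map_sub, hΦ, algHom_C, algebraMap_eq, mul_sub, ← C_mul, mul_inv_cancel_left₀ hm]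
    change Φ.toEquiv.symm '' _ = _
    ext x
    rw [Set.mem_image_equiv, Equiv.symm_symm, mem_hypersurface, mem_hypersurface,
      ← Φ.eval_pullback, hpull, map_mul, eval_C, mul_eq_zero, or_iff_right hm]
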